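/- Let a vector $d\in\mathbb{Z}^n$ be called TU-appendable to a totally unimodular matrix $T\in\{-1,0,1\}^{k\times n}$ if the matrix $\begin{pmatrix}T\\ d^\top\end{pmatrix}$ is totally unimodular, and let a vector $x\in\mathbb{Z}^n$ be called elementary with respect to $T$ if $d^\top x\in\{-1,0,1\}$ for all $d$ that are TU-appendable to $T$. (Decomposition lemma) Let $T\in\{-1,0,1\}^{k\times n}$ be a totally unimodular matrix, let $b\in\mathbb{Z}^k$, and let $x_0,y\in\mathbb{Z}^n$ be two solutions of the system $Tx\leq b$. Then one can determine in strongly polynomial time vectors $y^1,\ldots,y^n\in\mathbb{Z}^n$ and coefficients $\lambda_1,\ldots,\lambda_n\in\mathbb{Z}_{\geq 0}$ such that $y-x_0=\sum_{i=1}^n\lambda_i y^i$ and 1. $y^1,\ldots,y^n$ are elementary with respect to $T$; 2. for all $\mu_1,\ldots,\mu_n\in\mathbb{Z}_{\geq 0}$ with $\mu_i\leq\lambda_i$ for all $i\in\{1,\ldots,n\}$, the vector $\tilde y=x_0+\sum_{i=1}^n\mu_i y^i$ satisfies $T\tilde y\leq b$. Here strongly polynomial time means that a single algorithm, on input $(k,n,T,b,x_0,y)$,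 performs a number of elementary operations (integer addition, subtraction, multiplication, comparison, and memory access) bounded by a polynomial in the number of integers in the input, while all integers occurring in the computation have binary encoding length bounded by a polynomial in the total encoding length of the input. -/

import Mathlib

open Matrix

/-! ### Totally unimodular systems -/

/-- `d` is TU-appendable to `T`: the matrix `T` with the extra row `dᵀ` is totally unimodular. -/
def TUAppendable {k n : ℕ} (T : Matrix (Fin k) (Fin n) ℤ) (d : Fin n → ℤ) : Prop :=
  (Matrix.fromRows T (Matrix.replicateRow (Fin 1) d)).IsTotallyUnimodular

/-- `x` is elementary w.r.t. `T`: `dᵀ x ∈ {-1, 0, 1}` for all `d` that are TU-appendable to `T`. -/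
def IsElementary {k n : ℕ} (T : Matrix (Fin k) (Fin n) ℤ) (x : Fin n → ℤ) : Prop :=
  ∀ d : Fin n → ℤ, TUAppendable T d → d ⬝ᵥ x ∈ ({-1, 0, 1} : Set ℤ)

/-- The coefficients `lam i` and the vectors `Y i`, for `i = 1, …, n`, decompose `y - x₀` in the
required way with respect to the system `T x ≤ b`. -/
structure IsDecomposition {k n : ℕ} (T : Matrix (Fin k) (Fin n) ℤ) (b : Fin k → ℤ)
    (x₀ y : Fin n → ℤ) (lam : Fin n → ℤ) (Y : Fin n → Fin n → ℤ) : Prop where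
  nonneg : ∀ i, 0 ≤ lam i
  sum_eq : y - x₀ = ∑ i, lam i • Y i
  elementary : ∀ i, IsElementary T (Y i)
  feasible : ∀ mu : Fin n → ℤ, (∀ i, 0 ≤ mu i ∧ mu i ≤ lam i) →
    T *ᵥ (x₀ + ∑ i, mu i • Y i) ≤ b

/-! ### The machine model

A random access machine over the integers with unit-cost operations `+`, `-`, `*`, comparison and
indirect addressing, programmed by structured programs. There is neither division nor rounding, so
running times here are at least those in the usual arithmetic model. -/

/-- Memory: named two-dimensional arrays of integers;
`σ a i j` is the content of cell `(i, j)` of array `a`. -/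
abbrev Mem : Type := ℕ → ℤ → ℤ → ℤ

/-- Write the value `v` into cell `(i, j)` of array `a`. -/
def Mem.write (σ : Mem) (a : ℕ) (i j v : ℤ) : Mem :=
  fun a' i' j' => if a' = a ∧ i' = i ∧ j' = j then v else σ a' i' j'

/-- Integer expressions. -/
inductive Expr : Type
  | const (c : ℤ) : Expr
  | read (a : ℕ) (i j : Expr) : Expr
  | add (e₁ e₂ : Expr) : Expr
  | sub (e₁ e₂ : Expr) : Expr
  | mul (e₁ e₂ : Expr) : Expr

namespace Expr

/-- Value of an expression. -/
def eval (σ : Mem) : Expr → ℤ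
  | const c => c
  | read a i j => σ a (i.eval σ) (j.eval σ)
  | add e₁ e₂ => e₁.eval σ + e₂.eval σ
  | sub e₁ e₂ => e₁.eval σ - e₂.eval σ
  | mul e₁ e₂ => e₁.eval σ * e₂.eval σ

/-- Number of elementary operations needed to evaluate an expression. -/
def cost : Expr → ℕ
  | const _ => 1
  | read _ i j => i.cost + j.cost + 1
  | add e₁ e₂ => e₁.cost + e₂.cost + 1
  | sub e₁ e₂ => e₁.cost + e₂.cost + 1
  | mul e₁ e₂ => e₁.cost + e₂.cost + 1

end Expr

/-- Encoding length of an integer: a sign bit and the binary digits of the absolute value. -/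
def bitLength (z : ℤ) : ℕ := Nat.size z.natAbs + 1

/-- Every number that occurs in the evaluation of the expression, addresses included, has encoding
length at most `s`. -/
def Expr.Fits (s : ℕ) (σ : Mem) : Expr → Prop
  | .const c => bitLength c ≤ s
  | .read a i j =>
      i.Fits s σ ∧ j.Fits s σ ∧ bitLength ((Expr.read a i j).eval σ) ≤ s
  | .add e₁ e₂ =>
      e₁.Fits s σ ∧ e₂.Fits s σ ∧ bitLength ((Expr.add e₁ e₂).eval σ) ≤ s
  | .sub e₁ e₂ =>
      e₁.Fits s σ ∧ e₂.Fits s σ ∧ bitLength ((Expr.sub e₁ e₂).eval σ) ≤ s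
  | .mul e₁ e₂ =>
      e₁.Fits s σ ∧ e₂.Fits s σ ∧ bitLength ((Expr.mul e₁ e₂).eval σ) ≤ s

/-- Programs. -/
inductive Prog : Type
  | skip : Prog
  /-- `a[i, j] := e` -/
  | store (a : ℕ) (i j e : Expr) : Prog
  | seq (P Q : Prog) : Prog
  /-- `if e₁ ≤ e₂ then P else Q` -/
  | ite (e₁ e₂ : Expr) (P Q : Prog) : Prog
  /-- `while e₁ ≤ e₂ do P` -/
  | loop (e₁ e₂ : Expr) (P : Prog) : Prog

/-- `Exec s P σ t σ'`: the program `P`, started with memory `σ`, halts with memory `σ'` after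
exactly `t` elementary steps, and all numbers that occur during the computation have encoding
length at most `s`. -/
inductive Exec (s : ℕ) : Prog → Mem → ℕ → Mem → Prop
  | skip (σ : Mem) : Exec s .skip σ 1 σ
  | store (a : ℕ) (i j e : Expr) (σ : Mem) :
      i.Fits s σ → j.Fits s σ → e.Fits s σ →
      Exec s (.store a i j e) σ (i.cost + j.cost + e.cost + 1)
        (σ.write a (i.eval σ) (j.eval σ) (e.eval σ))
  | seq (P Q : Prog) (σ σ' σ'' : Mem) (t t' : ℕ) :
      Exec s P σ t σ' → Exec s Q σ' t' σ'' → Exec s (.seq P Q) σ (t + t') σ''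
  | ite_true (e₁ e₂ : Expr) (P Q : Prog) (σ σ' : Mem) (t : ℕ) :
      e₁.Fits s σ → e₂.Fits s σ → e₁.eval σ ≤ e₂.eval σ → Exec s P σ t σ' →
      Exec s (.ite e₁ e₂ P Q) σ (e₁.cost + e₂.cost + 1 + t) σ'
  | ite_false (e₁ e₂ : Expr) (P Q : Prog) (σ σ' : Mem) (t : ℕ) :
      e₁.Fits s σ → e₂.Fits s σ → ¬ e₁.eval σ ≤ e₂.eval σ → Exec s Q σ t σ' →
      Exec s (.ite e₁ e₂ P Q) σ (e₁.cost + e₂.cost + 1 + t) σ'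
  | loop_true (e₁ e₂ : Expr) (P : Prog) (σ σ' σ'' : Mem) (t t' : ℕ) :
      e₁.Fits s σ → e₂.Fits s σ → e₁.eval σ ≤ e₂.eval σ → Exec s P σ t σ' →
      Exec s (.loop e₁ e₂ P) σ' t' σ'' →
      Exec s (.loop e₁ e₂ P) σ (e₁.cost + e₂.cost + 1 + t + t') σ''
  | loop_false (e₁ e₂ : Expr) (P : Prog) (σ : Mem) :
      e₁.Fits s σ → e₂.Fits s σ → ¬ e₁.eval σ ≤ e₂.eval σ →
      Exec s (.loop e₁ e₂ P) σ (e₁.cost + e₂.cost + 1) σ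

/-! ### Input format -/

/-- The array with the entries of `A` in the cells `(i, j)`, `0 ≤ i < k`, `0 ≤ j < n`, and `0` in
all other cells. -/
def arrayOf {k n : ℕ} (A : Matrix (Fin k) (Fin n) ℤ) : ℤ → ℤ → ℤ
  | .ofNat i, .ofNat j => if h : i < k ∧ j < n then A ⟨i, h.1⟩ ⟨j, h.2⟩ else 0
  | _, _ => 0

/-- The initial memory: arrays `0, …, 5` hold `k`, `n`, `T`, `b`, `x₀`, `y` (scalars in cell
`(0, 0)`, vectors in column `0`); all other cells are `0`. -/
def inputMem {k n : ℕ} (T : Matrix (Fin k) (Fin n) ℤ) (b : Fin k → ℤ) (x₀ y : Fin n → ℤ) : Mem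
  | 0 => arrayOf (Matrix.replicateCol (Fin 1) fun _ : Fin 1 => (k : ℤ))
  | 1 => arrayOf (Matrix.replicateCol (Fin 1) fun _ : Fin 1 => (n : ℤ))
  | 2 => arrayOf T
  | 3 => arrayOf (Matrix.replicateCol (Fin 1) b)
  | 4 => arrayOf (Matrix.replicateCol (Fin 1) x₀)
  | 5 => arrayOf (Matrix.replicateCol (Fin 1) y)
  | _ => fun _ _ => 0

/-- The number of integers in the input `(k, n, T, b, x₀, y)`. -/
def inputCount (k n : ℕ) : ℕ := 2 + k * n + k + n + n

/-- The total encoding length of the input `(k, n, T, b, x₀, y)`. -/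
def inputLength {k n : ℕ} (T : Matrix (Fin k) (Fin n) ℤ) (b : Fin k → ℤ) (x₀ y : Fin n → ℤ) : ℕ :=
  bitLength k + bitLength n + (∑ i, ∑ j, bitLength (T i j)) + (∑ i, bitLength (b i)) +
    (∑ j, bitLength (x₀ j)) + ∑ j, bitLength (y j)

/-- The entries of a column of a basis inverse are, up to sign, subdeterminants. -/
theorem dotProduct_col_mem {n : ℕ} {A B : Matrix (Fin n) (Fin n) ℤ} (h : A * B = 1) (c : Fin n)
    (d : Fin n → ℤ) (hd : (A.updateRow c d).det ∈ ({-1, 0, 1} : Set ℤ)) :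
    (d ⬝ᵥ fun j => B j c) ∈ ({-1, 0, 1} : Set ℤ) := by
  have h1 : A.updateRow c d * B = (1 : Matrix (Fin n) (Fin n) ℤ).updateRow c (d ᵥ* B) := by
    rw [updateRow_mul, h]
  have h2 : ((1 : Matrix (Fin n) (Fin n) ℤ).updateRow c (d ᵥ* B)).det = d ⬝ᵥ fun j => B j c := by
    have : ((1 : Matrix (Fin n) (Fin n) ℤ).updateRow c (d ᵥ* B)).det = (d ᵥ* B) c := by
      rw [← det_transpose, ← updateCol_transpose, transpose_one, ← cramer_apply, cramer_one]; rfl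
    rw [this]; rfl
  have h3 : A.det * B.det = 1 := by rw [← det_mul, h, det_one]
  rw [← h2, ← h1, det_mul]
  rcases Int.eq_one_or_neg_one_of_mul_eq_one (mul_comm A.det _ ▸ h3) with hB | hB <;>
    rw [hB] <;> simp only [Set.mem_insert_iff, Set.mem_singleton_iff] at hd ⊢ <;> omega

section Tableau

variable {m n : ℕ}

/-- `N` is the tableau of the rows of `M` with respect to the basis formed by the rows `R`. -/
def IsTableau (M : Matrix (Fin m) (Fin n) ℤ) (R : Fin n → Fin m) (N : Matrix (Fin m) (Fin n) ℤ) :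
    Prop :=
  ∃ B : Matrix (Fin n) (Fin n) ℤ, M.submatrix R id * B = 1 ∧ N = M * B

/-- Exchange step: the column operations that turn row `i` into the unit vector `c`. -/
def pivotMat (N : Matrix (Fin m) (Fin n) ℤ) (c : Fin n) (i : Fin m) : Matrix (Fin m) (Fin n) ℤ :=
  Matrix.of fun j a => N j a - N j c * N i c * (N i a - if a = c then 1 else 0)

/-- The multiple of column `c` is subtracted that makes entry `i` of `w` vanish. -/
def pivotVec (N : Matrix (Fin m) (Fin n) ℤ) (c : Fin n) (i : Fin m) (w : Fin m → ℤ) : Fin m → ℤ :=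
  fun j => w j - N j c * N i c * w i

/-- `x` has the sign of `y`, or is zero. -/
def SignConform (x y : ℤ) : Prop := (0 ≤ y → 0 ≤ x) ∧ (y ≤ 0 → x ≤ 0)

/-- Row `i` meets column `c` and has the entry of `w` of least modulus among all such rows. -/
def IsRatioRow (N : Matrix (Fin m) (Fin n) ℤ) (w : Fin m → ℤ) (c : Fin n) (i : Fin m) : Prop :=
  N i c ≠ 0 ∧ ∀ j, N j c ≠ 0 → |w i| ≤ |w j|

/-- Every square matrix formed by rows of `M` and `d` has determinant `0` or `±1`. -/
def UnimodularWith (M : Matrix (Fin m) (Fin n) ℤ) (d : Fin n → ℤ) : Prop :=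
  ∀ (R : Fin n → Fin m) (c : Fin n),
    ((M.submatrix R id).updateRow c d).det ∈ ({-1, 0, 1} : Set ℤ)

variable {M N : Matrix (Fin m) (Fin n) ℤ} {R : Fin n → Fin m}

theorem SignConform.refl (x : ℤ) : SignConform x x := ⟨id, id⟩

theorem SignConform.trans {x y z : ℤ} (h : SignConform x y) (h' : SignConform y z) :
    SignConform x z := ⟨fun hz => h.1 (h'.1 hz), fun hz => h.2 (h'.2 hz)⟩

theorem SignConform.eq_zero {x : ℤ} (h : SignConform x 0) : x = 0 :=
  le_antisymm (h.2 le_rfl) (h.1 le_rfl)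

theorem IsTableau.apply_basis (h : IsTableau M R N) (a b : Fin n) :
    N (R a) b = if a = b then 1 else 0 := by
  obtain ⟨B, h1, rfl⟩ := h
  have := congrFun (congrFun h1 a) b
  rw [Matrix.one_apply] at this
  rw [← this]; rfl

theorem IsTableau.entry_mem (h : IsTableau M R N) (hM : ∀ j, UnimodularWith M (M j))
    (j : Fin m) (c : Fin n) : N j c = -1 ∨ N j c = 0 ∨ N j c = 1 := by
  obtain ⟨B, h1, rfl⟩ := h
  exact dotProduct_col_mem h1 c (M j) (hM j R c)

theorem IsTableau.apply_sum (h : IsTableau M R N) {w : Fin m → ℤ} (hw : ∃ v, w = M *ᵥ v)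
    (j : Fin m) : w j = ∑ a, N j a * w (R a) := by
  obtain ⟨B, h1, rfl⟩ := h
  obtain ⟨v, rfl⟩ := hw
  have h2 : (M * B) *ᵥ (M.submatrix R id *ᵥ v) = M *ᵥ v := by
    rw [Matrix.mulVec_mulVec, Matrix.mul_assoc, mul_eq_one_comm.mp h1, Matrix.mul_one]
  exact (congrFun h2 j).symm

theorem IsTableau.pivot (h : IsTableau M R N) (c : Fin n) (i : Fin m) (hi : N i c * N i c = 1) :
    IsTableau M (Function.update R c i) (pivotMat N c i) := by
  have hb := h.apply_basis
  obtain ⟨B, h1, rfl⟩ := h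
  set N := M * B with hN
  let E : Matrix (Fin n) (Fin n) ℤ := 1 - Matrix.of fun a a' =>
    (if a = c then 1 else 0) * (N i c * (N i a' - if a' = c then 1 else 0))
  have hE : N * E = pivotMat N c i := by
    ext j a
    simp only [E, Matrix.mul_sub, Matrix.mul_one, Matrix.sub_apply, pivotMat, Matrix.of_apply]
    congr 1
    rw [Matrix.mul_apply]
    simp [mul_assoc]
  refine ⟨B * E, ?_, by rw [← Matrix.mul_assoc, ← hN, hE]⟩
  have h3 : M.submatrix (Function.update R c i) id * (B * E)
      = (pivotMat N c i).submatrix (Function.update R c i) id := by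
    rw [← hE, hN, Matrix.mul_assoc]; rfl
  rw [h3]
  ext a b
  rw [Matrix.submatrix_apply, Matrix.one_apply]
  simp only [pivotMat, Matrix.of_apply, id]
  by_cases hac : a = c
  · subst hac
    rw [Function.update_self, hi]
    by_cases hab : a = b
    · simp [hab]
    · simp [hab, Ne.symm hab]
  · rw [Function.update_of_ne hac, hb a b, hb a c, if_neg hac]
    simp

theorem pivotVec_span (h : IsTableau M R N) (c : Fin n) (i : Fin m) {w : Fin m → ℤ}
    (hw : ∃ v, w = M *ᵥ v) : ∃ v, pivotVec N c i w = M *ᵥ v := by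
  obtain ⟨B, -, rfl⟩ := h
  obtain ⟨v, rfl⟩ := hw
  set N := M * B with hN
  refine ⟨v - (N i c * (M *ᵥ v) i) • fun a => B a c, ?_⟩
  rw [Matrix.mulVec_sub, Matrix.mulVec_smul]
  ext j
  have : (M *ᵥ fun a => B a c) j = N j c := rfl
  simp only [pivotVec, Pi.sub_apply, Pi.smul_apply, smul_eq_mul, this]
  ring

theorem pivotVec_self {c : Fin n} {i : Fin m} (w : Fin m → ℤ) (hi : N i c * N i c = 1) :
    pivotVec N c i w i = 0 := by
  simp [pivotVec, hi]

theorem IsTableau.pivotVec_of_ne (h : IsTableau M R N) {a c : Fin n} (hac : a ≠ c) (i : Fin m)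
    (w : Fin m → ℤ) : pivotVec N c i w (R a) = w (R a) := by
  simp [pivotVec, h.apply_basis, hac]

theorem IsTableau.mul_self_eq_one (h : IsTableau M R N) (hM : ∀ j, UnimodularWith M (M j))
    {j : Fin m} {c : Fin n} (hj : N j c ≠ 0) : N j c * N j c = 1 := by
  rcases h.entry_mem hM j c with h' | h' | h' <;> simp_all

theorem signConform_pivotVec (h : IsTableau M R N) (hM : ∀ j, UnimodularWith M (M j))
    {w : Fin m → ℤ} {c : Fin n} {i : Fin m} (hi : IsRatioRow N w c i) (j : Fin m) :
    SignConform (pivotVec N c i w j) (w j) := by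
  unfold pivotVec SignConform
  by_cases hj : N j c = 0
  · simp [hj]
  have h2 := hi.2 j hj
  rcases abs_cases (w i) with h3 | h3 <;> rcases abs_cases (w j) with h4 | h4 <;>
    rcases h.entry_mem hM i c with h5 | h5 | h5 <;>
    rcases h.entry_mem hM j c with h6 | h6 | h6 <;> rw [h5, h6] <;> omega

/-- State of the reduction after `p` rounds: `u` is what remains to be decomposed. -/
structure OuterInv (M : Matrix (Fin m) (Fin n) ℤ) (U : ℤ) (p : ℕ) (R : Fin n → Fin m)
    (N : Matrix (Fin m) (Fin n) ℤ) (u : Fin m → ℤ) : Prop where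
  tab : IsTableau M R N
  span : ∃ v, u = M *ᵥ v
  zero : ∀ a : Fin n, (a : ℕ) < p → u (R a) = 0
  bound : ∀ j, |u j| ≤ U

/-- State within round `p`, when the columns strictly between `p` and `c` have been treated:
`w` is a vector conformal to `u` that is being reduced to a multiple of column `p`. -/
structure InnerInv (M : Matrix (Fin m) (Fin n) ℤ) (U : ℤ) (p : Fin n) (u : Fin m → ℤ) (c : ℕ)
    (R : Fin n → Fin m) (N : Matrix (Fin m) (Fin n) ℤ) (w : Fin m → ℤ) : Prop where
  outer : OuterInv M U p R N u
  span : ∃ v, w = M *ᵥ v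
  conform : ∀ j, SignConform (w j) (u j)
  keep : w (R p) = u (R p)
  zero : ∀ a : Fin n, p < a → (a : ℕ) < c → w (R a) = 0
  bound : ∀ a, |w (R a)| ≤ U

theorem OuterInv.toInner {U : ℤ} {p : Fin n} {u : Fin m → ℤ} (h : OuterInv M U p R N u) :
    InnerInv M U p u (p + 1) R N u where
  outer := h
  span := h.span
  conform _ := SignConform.refl _
  keep := rfl
  zero a h1 h2 := by have : (p : ℕ) < a := h1; omega
  bound a := h.bound _

theorem IsTableau.exists_ne_zero (h : IsTableau M R N) (c : Fin n) : ∃ i, N i c ≠ 0 :=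
  ⟨R c, by simp [h.apply_basis]⟩

theorem InnerInv.abs_le {U : ℤ} {p : Fin n} {u w : Fin m → ℤ} {c : ℕ}
    (h : InnerInv M U p u c R N w) (hM : ∀ j, UnimodularWith M (M j)) (j : Fin m) :
    |w j| ≤ n * U := by
  rw [h.outer.tab.apply_sum h.span j]
  refine (Finset.abs_sum_le_sum_abs _ _).trans ?_
  have : ∀ a ∈ Finset.univ, |N j a * w (R a)| ≤ U := by
    intro a _
    rw [abs_mul]
    have h1 := h.bound a
    have h0 := abs_nonneg (w (R a))
    rcases h.outer.tab.entry_mem hM j a with h5 | h5 | h5 <;> rw [h5] <;> simp <;> omega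
  simpa using Finset.sum_le_card_nsmul _ _ _ this

theorem InnerInv.step {U : ℤ} {p c : Fin n} {u w : Fin m → ℤ} (h : InnerInv M U p u c R N w)
    (hM : ∀ j, UnimodularWith M (M j)) (hpc : p < c) {i : Fin m} (hi : IsRatioRow N w c i) :
    InnerInv M U p u (c + 1) (Function.update R c i) (pivotMat N c i) (pivotVec N c i w) := by
  have h1 := h.outer.tab.mul_self_eq_one hM hi.1
  have hR : ∀ a, a ≠ c → pivotVec N c i w (Function.update R c i a) = w (R a) := fun a ha => by
    rw [Function.update_of_ne ha, h.outer.tab.pivotVec_of_ne ha]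
  have hc : pivotVec N c i w (Function.update R c i c) = 0 := by
    rw [Function.update_self, pivotVec_self w h1]
  refine ⟨⟨h.outer.tab.pivot c i h1, h.outer.span, fun a ha => ?_, h.outer.bound⟩,
    pivotVec_span h.outer.tab c i h.span,
    fun j => (signConform_pivotVec h.outer.tab hM hi j).trans (h.conform j), ?_,
    fun a ha1 ha2 => ?_, fun a => ?_⟩
  · have : a ≠ c := by rintro rfl; exact absurd hpc (not_lt.mpr ha.le)
    rw [Function.update_of_ne this, h.outer.zero a ha]
  · rw [hR p hpc.ne, Function.update_of_ne hpc.ne, h.keep]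
  · by_cases hac : a = c
    · rw [hac, hc]
    · rw [hR a hac, h.zero a ha1 (lt_of_le_of_ne (by omega) (fun h => hac (Fin.ext h)))]
  · by_cases hac : a = c
    · rw [hac, hc, abs_zero]; exact (abs_nonneg _).trans (h.bound a)
    · rw [hR a hac]; exact h.bound a

/-- After the inner reduction column `p`, suitably scaled, is conformal to `u`. -/
theorem InnerInv.conform_col {U : ℤ} {p : Fin n} {u w : Fin m → ℤ}
    (h : InnerInv M U p u n R N w) (j : Fin m) : SignConform (N j p * u (R p)) (u j) := by
  have h1 : w j = N j p * u (R p) := by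
    rw [h.outer.tab.apply_sum h.span j, ← h.keep]
    refine Finset.sum_eq_single p (fun a _ ha => ?_) (by simp)
    rcases lt_or_gt_of_ne ha with h2 | h2
    · have h3 := h.conform (R a)
      rw [h.outer.zero a h2] at h3
      rw [h3.eq_zero, mul_zero]
    · rw [h.zero a h2 a.2, mul_zero]
  rw [← h1]
  exact h.conform j

theorem OuterInv.step {U : ℤ} {p : Fin n} {u : Fin m → ℤ} (h : OuterInv M U p R N u)
    (hM : ∀ j, UnimodularWith M (M j)) (hconf : ∀ j, SignConform (N j p * u (R p)) (u j))
    {i : Fin m} (hi : IsRatioRow N u p i) :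
    OuterInv M U (p + 1) (Function.update R p i) (pivotMat N p i) (pivotVec N p i u) ∧
    ∀ j, u j = pivotVec N p i u j + u i * pivotMat N p i j p ∧
      SignConform (u i * pivotMat N p i j p) (u j) ∧ SignConform (pivotVec N p i u j) (u j) := by
  have h1 := h.tab.mul_self_eq_one hM hi.1
  have hcol : ∀ j, pivotMat N p i j p = N j p * N i p := fun j => by
    simp only [pivotMat, Matrix.of_apply, if_true]
    linear_combination (-N j p) * h1
  have hsplit : ∀ j, u j = pivotVec N p i u j + u i * pivotMat N p i j p := fun j => by
    rw [hcol, pivotVec]; ring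
  have hterm : ∀ j, SignConform (u i * pivotMat N p i j p) (u j) := fun j => by
    rw [hcol]
    have e1 := hconf i
    have e2 := hconf j
    have e3 := hi.2 (R p) (by simp [h.tab.apply_basis])
    unfold SignConform at *
    rcases abs_cases (u i) with h3 | h3 <;> rcases abs_cases (u (R p)) with h4 | h4 <;>
    rcases h.tab.entry_mem hM i p with h5 | h5 | h5 <;>
    rcases h.tab.entry_mem hM j p with h6 | h6 | h6 <;> rw [h5] at e1 ⊢ <;>
    rw [h6] at e2 ⊢ <;> omega
  have hrest : ∀ j, SignConform (pivotVec N p i u j) (u j) := signConform_pivotVec h.tab hM hi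
  refine ⟨⟨h.tab.pivot p i h1, pivotVec_span h.tab p i h.span, fun a ha => ?_, fun j => ?_⟩,
    fun j => ⟨hsplit j, hterm j, hrest j⟩⟩
  · by_cases hap : a = p
    · rw [hap, Function.update_self, pivotVec_self u h1]
    · rw [Function.update_of_ne hap, h.tab.pivotVec_of_ne hap]
      exact h.zero a (lt_of_le_of_ne (by omega) (fun h => hap (Fin.ext h)))
  · refine le_trans ?_ (h.bound j)
    have e1 := hsplit j
    have e2 := hterm j
    have e3 := hrest j
    unfold SignConform at e2 e3
    rcases abs_cases (u j) with h3 | h3 <;>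
      rcases abs_cases (pivotVec N p i u j) with h4 | h4 <;> omega

theorem OuterInv.eq_zero {U : ℤ} {u : Fin m → ℤ} (h : OuterInv M U n R N u) (j : Fin m) :
    u j = 0 := by
  rw [h.tab.apply_sum h.span j]
  exact Finset.sum_eq_zero fun a _ => by rw [h.zero a a.2, mul_zero]

end Tableau

section System

variable {k n : ℕ}

/-- The unit rows on top of the rows of `T`. -/
def stacked (T : Matrix (Fin k) (Fin n) ℤ) : Matrix (Fin (n + k)) (Fin n) ℤ :=
  Matrix.of (Fin.append (fun i : Fin n => (Pi.single i 1 : Fin n → ℤ)) T)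

theorem stacked_castAdd (T : Matrix (Fin k) (Fin n) ℤ) (i : Fin n) :
    stacked T (Fin.castAdd k i) = Pi.single i 1 :=
  Fin.append_left (fun i : Fin n => (Pi.single i 1 : Fin n → ℤ)) T i

theorem stacked_natAdd (T : Matrix (Fin k) (Fin n) ℤ) (i : Fin k) :
    stacked T (Fin.natAdd n i) = T i :=
  Fin.append_right (fun i : Fin n => (Pi.single i 1 : Fin n → ℤ)) T i

theorem stacked_mulVec_castAdd (T : Matrix (Fin k) (Fin n) ℤ) (v : Fin n → ℤ) (i : Fin n) :
    (stacked T *ᵥ v) (Fin.castAdd k i) = v i := by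
  rw [mulVec, stacked_castAdd, single_one_dotProduct]

theorem stacked_mulVec_natAdd (T : Matrix (Fin k) (Fin n) ℤ) (v : Fin n → ℤ) (i : Fin k) :
    (stacked T *ᵥ v) (Fin.natAdd n i) = (T *ᵥ v) i := by
  rw [mulVec, stacked_natAdd]; rfl

theorem unimodularWith_of_appendable {T : Matrix (Fin k) (Fin n) ℤ} {d : Fin n → ℤ}
    (hd : TUAppendable T d) : UnimodularWith (stacked T) d := by
  intro R c
  set G := fromRows (fromRows T (replicateRow (Fin 1) d)) (1 : Matrix (Fin n) (Fin n) ℤ) with hG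
  have hTU : G.IsTotallyUnimodular := (fromRows_one_isTotallyUnimodular_iff _).mpr hd
  have hrow : ∀ j : Fin (n + k), ∃ r, G r = stacked T j := fun j => by
    refine Fin.addCases (fun i => ?_) (fun i => ?_) j
    · refine ⟨Sum.inr i, ?_⟩
      rw [stacked_castAdd]
      ext a
      simp [hG, Matrix.one_apply, Pi.single_apply, eq_comm]
    · exact ⟨Sum.inl (Sum.inl i), by rw [stacked_natAdd]; rfl⟩
  have hrow' : ∀ a : Fin n, ∃ r, G r = ((stacked T).submatrix R id).updateRow c d a := fun a => by
    by_cases hac : a = c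
    · subst hac
      exact ⟨Sum.inl (Sum.inr 0), by rw [updateRow_self]; rfl⟩
    · obtain ⟨r, hr⟩ := hrow (R a)
      exact ⟨r, by rw [hr, updateRow_ne hac]; rfl⟩
  choose f hf using hrow'
  have hsub : ((stacked T).submatrix R id).updateRow c d = G.submatrix f id := by
    ext a b; rw [← hf]; rfl
  obtain ⟨s, hs⟩ := (isTotallyUnimodular_iff G).mp hTU n f id
  rw [hsub, ← hs]
  cases s <;> simp

theorem appendable_row {T : Matrix (Fin k) (Fin n) ℤ} (hT : T.IsTotallyUnimodular) (i : Fin k) :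
    TUAppendable T (T i) := by
  have : fromRows T (replicateRow (Fin 1) (T i)) = T.submatrix (Sum.elim id fun _ => i) id := by
    ext a b; rcases a with a | a <;> rfl
  rw [TUAppendable, this]
  exact hT.submatrix _ _

theorem appendable_single {T : Matrix (Fin k) (Fin n) ℤ} (hT : T.IsTotallyUnimodular)
    (i : Fin n) : TUAppendable T (Pi.single i 1) := by
  have h := ((fromRows_one_isTotallyUnimodular_iff T).mpr hT).submatrix
    (Sum.elim Sum.inl fun _ : Fin 1 => Sum.inr i) id
  rw [TUAppendable]
  convert h using 1
  ext a b
  rcases a with a | a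
  · rfl
  · simp [Matrix.one_apply, Pi.single_apply, eq_comm]

theorem unimodularWith_row {T : Matrix (Fin k) (Fin n) ℤ} (hT : T.IsTotallyUnimodular)
    (j : Fin (n + k)) : UnimodularWith (stacked T) (stacked T j) := by
  refine Fin.addCases (fun i => ?_) (fun i => ?_) j
  · rw [stacked_castAdd]; exact unimodularWith_of_appendable (appendable_single hT i)
  · rw [stacked_natAdd]; exact unimodularWith_of_appendable (appendable_row hT i)

/-- The upper part of every column of a tableau is an elementary vector. -/
theorem IsTableau.elementary_col {T : Matrix (Fin k) (Fin n) ℤ} {R : Fin n → Fin (n + k)}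
    {N : Matrix (Fin (n + k)) (Fin n) ℤ} (h : IsTableau (stacked T) R N) (c : Fin n) :
    IsElementary T (fun j => N (Fin.castAdd k j) c) ∧
      ∀ j, (stacked T *ᵥ fun j => N (Fin.castAdd k j) c) j = N j c := by
  obtain ⟨B, h1, rfl⟩ := h
  have h2 : (fun j => (stacked T * B) (Fin.castAdd k j) c) = fun j => B j c := by
    ext j; exact stacked_mulVec_castAdd T (fun j => B j c) j
  rw [h2]
  exact ⟨fun d hd => dotProduct_col_mem h1 c d (unimodularWith_of_appendable hd R c),
    fun j => rfl⟩

theorem IsElementary.neg {T : Matrix (Fin k) (Fin n) ℤ} {x : Fin n → ℤ} (h : IsElementary T x) :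
    IsElementary T (-x) := fun d hd => by
  have := h d hd
  rw [dotProduct_neg]
  simp only [Set.mem_insert_iff, Set.mem_singleton_iff] at this ⊢
  omega

theorem isTableau_stacked (T : Matrix (Fin k) (Fin n) ℤ) :
    IsTableau (stacked T) (Fin.castAdd k) (stacked T) := by
  refine ⟨1, ?_, by simp⟩
  ext a b
  rw [Matrix.mul_one, submatrix_apply, stacked_castAdd, Matrix.one_apply]
  simp [Pi.single_apply, eq_comm]

/-- A conformal decomposition into elementary vectors stays within the feasible region. -/
theorem isDecomposition_of_conform {T : Matrix (Fin k) (Fin n) ℤ} {b : Fin k → ℤ}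
    {x₀ y : Fin n → ℤ} {lam : Fin n → ℤ} {Y : Fin n → Fin n → ℤ} (hx : T *ᵥ x₀ ≤ b)
    (hy : T *ᵥ y ≤ b) (hlam : ∀ i, 0 ≤ lam i) (hel : ∀ i, IsElementary T (Y i))
    (hsum : ∀ j, (stacked T *ᵥ (y - x₀)) j = ∑ i, lam i * (stacked T *ᵥ Y i) j)
    (hconf : ∀ i j, SignConform (lam i * (stacked T *ᵥ Y i) j) ((stacked T *ᵥ (y - x₀)) j)) :
    IsDecomposition T b x₀ y lam Y := by
  refine ⟨hlam, ?_, hel, fun mu hmu r => ?_⟩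
  · ext j
    have := hsum (Fin.castAdd k j)
    simp only [stacked_mulVec_castAdd] at this
    simpa using this
  · have h1 := hsum (Fin.natAdd n r)
    have h2 := fun i => hconf i (Fin.natAdd n r)
    simp only [stacked_mulVec_natAdd] at h1 h2
    have h3 : (T *ᵥ (x₀ + ∑ i, mu i • Y i)) r = (T *ᵥ x₀) r + ∑ i, mu i * (T *ᵥ Y i) r := by
      rw [mulVec_add, mulVec_sum, Pi.add_apply, Finset.sum_apply]
      simp only [mulVec_smul, Pi.smul_apply, smul_eq_mul]
    rw [h3]
    change (T *ᵥ x₀) r + ∑ i, mu i * (T *ᵥ Y i) r ≤ b r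
    have h4 : (T *ᵥ (y - x₀)) r = (T *ᵥ y) r - (T *ᵥ x₀) r := by rw [mulVec_sub]; rfl
    have hxr : (T *ᵥ x₀) r ≤ b r := hx r
    have hyr : (T *ᵥ y) r ≤ b r := hy r
    rcases le_total 0 ((T *ᵥ (y - x₀)) r) with h5 | h5
    · have : ∑ i, mu i * (T *ᵥ Y i) r ≤ ∑ i, lam i * (T *ᵥ Y i) r := by
        refine Finset.sum_le_sum fun i _ => ?_
        have h6 := (h2 i).1 h5
        rcases le_or_gt 0 ((T *ᵥ Y i) r) with h7 | h7
        · exact mul_le_mul_of_nonneg_right (hmu i).2 h7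
        · have : lam i = 0 := by have := hlam i; nlinarith
          have : mu i = 0 := by have := hmu i; omega
          simp [*]
      omega
    · have : ∑ i, mu i * (T *ᵥ Y i) r ≤ 0 := by
        refine Finset.sum_nonpos fun i _ => ?_
        have h6 := (h2 i).2 h5
        rcases le_or_gt ((T *ᵥ Y i) r) 0 with h7 | h7
        · exact mul_nonpos_of_nonneg_of_nonpos (hmu i).1 h7
        · have : lam i = 0 := by have := hlam i; nlinarith
          have : mu i = 0 := by have := hmu i; omega
          simp [*]
      omega

end System

section Logic

/-- All memory cells hold numbers of modulus at most `V`. -/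
def Bounded (V : ℤ) (σ : Mem) : Prop := ∀ a i j, |σ a i j| ≤ V

/-- Numbers up to the thirtieth power of `V` have encoding length at most `s`. -/
def Room (s : ℕ) (V : ℤ) : Prop := 2 ≤ V ∧ ∀ z : ℤ, |z| ≤ V ^ 30 → bitLength z ≤ s

/-- All constants in the expression are `0` or `±1`. -/
def Expr.unitConsts : Expr → Bool
  | .const c => decide (c.natAbs ≤ 1)
  | .read _ i j => i.unitConsts && j.unitConsts
  | .add e₁ e₂ => e₁.unitConsts && e₂.unitConsts
  | .sub e₁ e₂ => e₁.unitConsts && e₂.unitConsts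
  | .mul e₁ e₂ => e₁.unitConsts && e₂.unitConsts

/-- The expression is short and its constants are `0` or `±1`. -/
def Expr.Simple (e : Expr) : Prop := e.unitConsts = true ∧ e.cost ≤ 30

instance (e : Expr) : Decidable e.Simple := inferInstanceAs (Decidable (_ ∧ _))

theorem Expr.cost_pos (e : Expr) : 1 ≤ e.cost := by cases e <;> simp [Expr.cost]

theorem Expr.abs_eval_le {V : ℤ} (hV : 2 ≤ V) {σ : Mem} (hσ : Bounded V σ) (e : Expr)
    (he : e.unitConsts = true) : |e.eval σ| ≤ V ^ e.cost := by
  have hpow : ∀ a b : ℕ, V ^ a + V ^ b ≤ V ^ (a + b + 1) := fun a b => by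
    have h1 : (1 : ℤ) ≤ V ^ a := one_le_pow₀ (by omega)
    have h2 : (1 : ℤ) ≤ V ^ b := one_le_pow₀ (by omega)
    rw [pow_succ, pow_add]
    have h3 : V ^ a * V ^ b * 2 ≤ V ^ a * V ^ b * V := mul_le_mul_of_nonneg_left hV (by positivity)
    nlinarith
  have hone : ∀ a : ℕ, 1 ≤ a → V ≤ V ^ a := fun a ha => le_self_pow₀ (by omega) (by omega)
  induction e with
  | const c =>
    simp only [Expr.unitConsts, decide_eq_true_eq] at he
    simp only [Expr.eval, Expr.cost, pow_one]
    have := Int.abs_eq_natAbs c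
    omega
  | read a i j _ _ => exact (hσ _ _ _).trans (hone _ (Expr.cost_pos _))
  | add e₁ e₂ ih₁ ih₂ =>
    simp only [Expr.unitConsts, Bool.and_eq_true] at he
    exact (abs_add_le _ _).trans ((add_le_add (ih₁ he.1) (ih₂ he.2)).trans (hpow _ _))
  | sub e₁ e₂ ih₁ ih₂ =>
    simp only [Expr.unitConsts, Bool.and_eq_true] at he
    exact (abs_sub _ _).trans ((add_le_add (ih₁ he.1) (ih₂ he.2)).trans (hpow _ _))
  | mul e₁ e₂ ih₁ ih₂ =>
    simp only [Expr.unitConsts, Bool.and_eq_true] at he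
    simp only [Expr.eval, Expr.cost, abs_mul]
    calc |e₁.eval σ| * |e₂.eval σ| ≤ V ^ e₁.cost * V ^ e₂.cost :=
          mul_le_mul (ih₁ he.1) (ih₂ he.2) (abs_nonneg _) (pow_nonneg (by omega) _)
      _ = V ^ (e₁.cost + e₂.cost) := (pow_add _ _ _).symm
      _ ≤ V ^ (e₁.cost + e₂.cost + 1) := pow_le_pow_right₀ (by omega) (by omega)

theorem Expr.Simple.fits {s : ℕ} {V : ℤ} (h : Room s V) {σ : Mem} (hσ : Bounded V σ) {e : Expr}
    (he : e.Simple) : e.Fits s σ := by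
  have key : ∀ e : Expr, e.unitConsts = true → e.cost ≤ 30 → bitLength (e.eval σ) ≤ s :=
    fun e h1 h2 => h.2 _ ((e.abs_eval_le h.1 hσ h1).trans
      (pow_le_pow_right₀ (by have := h.1; omega) h2))
  obtain ⟨h1, h2⟩ := he
  induction e with
  | const c => exact key _ h1 h2
  | read a i j ih₁ ih₂ | add i j ih₁ ih₂ | sub i j ih₁ ih₂ | mul i j ih₁ ih₂ =>
    have h3 := key _ h1 h2
    simp only [Expr.unitConsts, Bool.and_eq_true] at h1
    simp only [Expr.cost] at h2
    exact ⟨ih₁ h1.1 (by omega), ih₂ h1.2 (by omega), h3⟩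

/-- Started with a bounded memory `σ`, the program halts within `t` steps, with a bounded memory
that satisfies `Q`. -/
def WP (s : ℕ) (V : ℤ) (P : Prog) (t : ℕ) (Q : Mem → Prop) (σ : Mem) : Prop :=
  Bounded V σ → ∃ t' σ', t' ≤ t ∧ Exec s P σ t' σ' ∧ Bounded V σ' ∧ Q σ'

variable {s : ℕ} {V : ℤ} {σ : Mem} {Q Q' : Mem → Prop} {P P' : Prog} {t t' : ℕ}

theorem Mem.write_same (σ : Mem) (a : ℕ) (i j v : ℤ) : (σ.write a i j v) a i j = v := by
  simp [Mem.write]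

theorem Mem.write_apply (σ : Mem) (a : ℕ) (i j v i' j' : ℤ) :
    (σ.write a i j v) a i' j' = if i' = i ∧ j' = j then v else σ a i' j' := by
  simp [Mem.write]

theorem Mem.write_of_ne (σ : Mem) {a a' : ℕ} (h : a' ≠ a) (i j v : ℤ) :
    (σ.write a i j v) a' = σ a' := by
  ext i' j'; simp [Mem.write, h]

theorem Bounded.write (h : Bounded V σ) (a : ℕ) (i j : ℤ) {v : ℤ} (hv : |v| ≤ V) :
    Bounded V (σ.write a i j v) := by
  intro a' i' j'
  unfold Mem.write
  split_ifs
  · exact hv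
  · exact h _ _ _

theorem WP.mono (h : WP s V P t Q σ) (ht : t ≤ t') (hQ : ∀ σ', Q σ' → Q' σ') :
    WP s V P t' Q' σ := fun hσ =>
  let ⟨r, σ', h1, h2, h3, h4⟩ := h hσ
  ⟨r, σ', h1.trans ht, h2, h3, hQ _ h4⟩

theorem WP.skip (ht : 1 ≤ t) (h : Q σ) : WP s V .skip t Q σ := fun hσ =>
  ⟨1, σ, ht, .skip σ, hσ, h⟩

theorem WP.store (hR : Room s V) {a : ℕ} {i j e : Expr} (hi : i.Simple) (hj : j.Simple)
    (he : e.Simple) (ht : 100 ≤ t) (hv : Bounded V σ → |e.eval σ| ≤ V)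
    (h : Q (σ.write a (i.eval σ) (j.eval σ) (e.eval σ))) : WP s V (.store a i j e) t Q σ :=
  fun hσ => ⟨_, _, by have := hi.2; have := hj.2; have := he.2; omega,
    .store a i j e σ (hi.fits hR hσ) (hj.fits hR hσ) (he.fits hR hσ),
    hσ.write _ _ _ (hv hσ), h⟩

theorem WP.seq (h : WP s V P t Q σ) (h' : ∀ σ', Q σ' → WP s V P' t' Q' σ') :
    WP s V (.seq P P') (t + t') Q' σ := fun hσ =>
  let ⟨_, _, h1, h2, h3, h4⟩ := h hσ
  let ⟨_, _, h1', h2', h3', h4'⟩ := h' _ h4 h3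
  ⟨_, _, add_le_add h1 h1', .seq _ _ _ _ _ _ _ h2 h2', h3', h4'⟩

theorem WP.ite (hR : Room s V) {e₁ e₂ : Expr} (h₁ : e₁.Simple) (h₂ : e₂.Simple)
    (h : e₁.eval σ ≤ e₂.eval σ → WP s V P t Q σ)
    (h' : ¬ e₁.eval σ ≤ e₂.eval σ → WP s V P' t Q σ) :
    WP s V (.ite e₁ e₂ P P') (100 + t) Q σ := fun hσ => by
  have c₁ := h₁.2
  have c₂ := h₂.2
  by_cases hc : e₁.eval σ ≤ e₂.eval σ
  · obtain ⟨r, σ', r1, r2, r3, r4⟩ := h hc hσ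
    exact ⟨_, σ', by omega,
      .ite_true _ _ _ _ _ _ _ (h₁.fits hR hσ) (h₂.fits hR hσ) hc r2, r3, r4⟩
  · obtain ⟨r, σ', r1, r2, r3, r4⟩ := h' hc hσ
    exact ⟨_, σ', by omega,
      .ite_false _ _ _ _ _ _ _ (h₁.fits hR hσ) (h₂.fits hR hσ) hc r2, r3, r4⟩

/-- The scalar variable kept in cell `(0, 0)` of array `v`. -/
def var (v : ℕ) : Expr := .read v (.const 0) (.const 0)

/-- Assignment to a scalar variable. -/
def assign (v : ℕ) (e : Expr) : Prog := .store v (.const 0) (.const 0) e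

/-- `for v = lo, …, hi - 1 do body` -/
def forLoop (v : ℕ) (lo hi : Expr) (body : Prog) : Prog :=
  .seq (assign v lo)
    (.loop (.add (var v) (.const 1)) hi (.seq body (assign v (.add (var v) (.const 1)))))

@[simp] theorem eval_var (v : ℕ) (σ : Mem) : (var v).eval σ = σ v 0 0 := rfl

@[simp] theorem eval_const (c : ℤ) (σ : Mem) : (Expr.const c).eval σ = c := rfl

@[simp] theorem eval_read (a : ℕ) (i j : Expr) (σ : Mem) :
    (Expr.read a i j).eval σ = σ a (i.eval σ) (j.eval σ) := rfl

@[simp] theorem eval_add (e₁ e₂ : Expr) (σ : Mem) :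
    (Expr.add e₁ e₂).eval σ = e₁.eval σ + e₂.eval σ := rfl

@[simp] theorem eval_sub (e₁ e₂ : Expr) (σ : Mem) :
    (Expr.sub e₁ e₂).eval σ = e₁.eval σ - e₂.eval σ := rfl

@[simp] theorem eval_mul (e₁ e₂ : Expr) (σ : Mem) :
    (Expr.mul e₁ e₂).eval σ = e₁.eval σ * e₂.eval σ := rfl

theorem WP.assign (hR : Room s V) {v : ℕ} {e : Expr} (he : e.Simple) (ht : 100 ≤ t)
    (hv : Bounded V σ → |e.eval σ| ≤ V) (h : Q (σ.write v 0 0 (e.eval σ))) :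
    WP s V (assign v e) t Q σ :=
  WP.store hR (by decide) (by decide) he ht hv h

/-- Running time of a loop with at most `X` iterations of time `t`. -/
def timeFor {S : Type} [Semiring S] (X t : S) : S := X * (t + 300) + 300

theorem WP.forLoop (hR : Room s V) {v : ℕ} {lo hi : Expr} {body : Prog} (I : ℤ → Mem → Prop)
    {l h : ℤ} {X : ℕ} (hlo : lo.Simple) (hhi : hi.Simple) (hel : lo.eval σ = l) (hlh : l ≤ h)
    (hX : h - l ≤ X) (hl0 : 0 ≤ l) (hhV : h ≤ V) (hI0 : I l σ)
    (hIv : ∀ i σ x, I i σ → I i (σ.write v 0 0 x))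
    (heh : ∀ i σ, I i σ → hi.eval σ = h)
    (hbody : ∀ i σ, l ≤ i → i < h → I i σ → σ v 0 0 = i →
      WP s V body t (fun σ' => σ' v 0 0 = i ∧ I (i + 1) σ') σ)
    (hQ : ∀ σ', I h σ' → Q σ') :
    WP s V (forLoop v lo hi body) (timeFor X t) Q σ := by
  have hvar : (Expr.add (var v) (.const 1)).Simple := by
    constructor <;> simp [Expr.unitConsts, Expr.cost, var]
  have hc1 := hvar.2
  have hc2 := hhi.2
  have main : ∀ (d : ℕ) (i : ℤ) (σ : Mem), i + d = h → l ≤ i → I i σ → σ v 0 0 = i →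
      WP s V (.loop (.add (var v) (.const 1)) hi
        (.seq body (_root_.assign v (.add (var v) (.const 1))))) (d * (t + 300) + 100) (I h) σ := by
    intro d
    induction d with
    | zero =>
      intro i σ hi1 hi2 hI hv hσ
      have hih : i = h := by simpa using hi1
      refine ⟨_, σ, ?_, .loop_false _ _ _ _ (hvar.fits hR hσ) (hhi.fits hR hσ) ?_, hσ, hih ▸ hI⟩
      · omega
      · rw [heh i σ hI, eval_add, eval_var, eval_const, hv]; omega
    | succ d ih =>
      intro i σ hi1 hi2 hI hv hσ
      push_cast at hi1
      have hih : i < h := by omega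
      obtain ⟨t₁, σ₁, r1, r2, r3, r4, r5⟩ := hbody i σ hi2 hih hI hv hσ
      have hev : (Expr.add (var v) (.const 1)).eval σ₁ = i + 1 := by
        rw [eval_add, eval_var, eval_const, r4]
      obtain ⟨t₂, σ₂, q1, q2, q3, q4⟩ := WP.assign (Q := fun σ' => σ' v 0 0 = i + 1 ∧ I (i + 1) σ')
        (t := 100) hR hvar le_rfl (fun _ => by rw [hev]; exact abs_le.mpr (by omega))
        (by rw [hev]; exact ⟨Mem.write_same _ _ _ _ _, hIv _ _ _ r5⟩) r3
      obtain ⟨t₃, σ₃, p1, p2, p3, p4⟩ := ih (i + 1) σ₂ (by omega) (by omega) q4.2 q4.1 q3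
      refine ⟨_, σ₃, ?_, .loop_true _ _ _ _ _ _ _ _ (hvar.fits hR hσ) (hhi.fits hR hσ) ?_
        (.seq _ _ _ _ _ _ _ r2 q2) p2, p3, p4⟩
      · rw [Nat.add_mul]; omega
      · rw [heh i σ hI, eval_add, eval_var, eval_const, hv]; omega
  have hd : l + ((h - l).toNat : ℕ) = h := by omega
  have hdX : (h - l).toNat ≤ X := by omega
  refine WP.mono (WP.seq (Q := fun σ' => σ' v 0 0 = l ∧ I l σ') (t := 100)
    (WP.assign hR hlo le_rfl (fun _ => by rw [hel]; exact abs_le.mpr (by omega))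
      (by rw [hel]; exact ⟨Mem.write_same _ _ _ _ _, hIv _ _ _ hI0⟩))
    (fun σ' hσ' => main _ l σ' hd le_rfl hσ'.2 hσ'.1)) ?_ hQ
  have := Nat.mul_le_mul_right (t + 300) hdX
  simp only [timeFor]
  omega

/-- The memories agree outside the arrays in `S`. -/
def Frame (S : List ℕ) (σ σ' : Mem) : Prop := ∀ a, a ∉ S → σ' a = σ a

theorem Frame.refl (S : List ℕ) (σ : Mem) : Frame S σ σ := fun _ _ => rfl

theorem Frame.write {S : List ℕ} {σ σ' : Mem} (h : Frame S σ σ') {a : ℕ} (ha : a ∈ S)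
    (i j v : ℤ) : Frame S σ (σ'.write a i j v) := fun a' ha' => by
  have hne : a' ≠ a := by rintro rfl; exact ha' ha
  rw [Mem.write_of_ne _ hne, h a' ha']

theorem Frame.trans {S S' S'' : List ℕ} {σ σ' σ'' : Mem} (h : Frame S σ σ') (h' : Frame S' σ' σ'')
    (h₁ : S ⊆ S'') (h₂ : S' ⊆ S'') : Frame S'' σ σ'' := fun a ha => by
  rw [h' a (fun h => ha (h₂ h)), h a (fun h => ha (h₁ h))]

end Logic

section Program

/-! ### The program

Arrays `8` and `9` hold the tableau (with the vector to be reduced in column `n`) and the remaining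
vector; array `10` holds a saved tableau row. The scalars are `11` (round), `12` (column),
`13`, `14` (loop counters), `15` (pivot row), `16` (pivot element) and `17` (factor or sign). -/

/-- The number `n + k` of rows of the tableau. -/
def rowCount : Expr := .add (var 1) (var 0)

/-- Entry of the tableau. -/
def tab (i j : Expr) : Expr := .read 8 i j

/-- The square of an expression. -/
def Expr.sq (e : Expr) : Expr := .mul e e

/-- Find a row in the support of the current column with least entry in column `n`. -/
def searchRow : Prog :=
  .seq (assign 15 (.const 0))
    (forLoop 13 (.const 0) rowCount
      (.ite (.const 1) (tab (var 13) (var 12)).sq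
        (.ite (.const 1) (tab (var 15) (var 12)).sq
          (.ite (tab (var 15) (var 1)).sq (tab (var 13) (var 1)).sq .skip (assign 15 (var 13)))
          (assign 15 (var 13)))
        .skip))

/-- Save the pivot row, minus the unit vector of the current column, and the pivot element. -/
def saveRow : Prog :=
  .seq (forLoop 14 (.const 0) (.add (var 1) (.const 1))
      (.store 10 (var 14) (.const 0) (tab (var 15) (var 14))))
    (.seq (.store 10 (var 12) (.const 0) (.sub (.read 10 (var 12) (.const 0)) (.const 1)))
      (assign 16 (tab (var 15) (var 12))))

/-- Subtract multiples of the saved row. -/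
def eliminate : Prog :=
  forLoop 13 (.const 0) rowCount
    (.seq (assign 17 (.mul (tab (var 13) (var 12)) (var 16)))
      (forLoop 14 (.const 0) (.add (var 1) (.const 1))
        (.store 8 (var 13) (var 14)
          (.sub (tab (var 13) (var 14)) (.mul (var 17) (.read 10 (var 14) (.const 0)))))))

/-- Exchange step in the current column. -/
def pivotProg : Prog := .seq searchRow (.seq saveRow eliminate)

/-- Copy array `9` into column `n` of the tableau. -/
def loadVec : Prog :=
  forLoop 13 (.const 0) rowCount
    (.store 8 (var 13) (var 1) (.read 9 (var 13) (.const 0)))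

/-- Copy column `n` of the tableau into array `9`. -/
def storeVec : Prog :=
  forLoop 13 (.const 0) rowCount
    (.store 9 (var 13) (.const 0) (tab (var 13) (var 1)))

/-- Write coefficient and vector of the current round to the output. -/
def emit : Prog :=
  .seq (.ite (.const 0) (.read 10 (var 1) (.const 0)) (assign 17 (.const 1))
      (assign 17 (.const (-1))))
    (.seq (.store 6 (var 11) (.const 0) (.mul (var 17) (.read 10 (var 1) (.const 0))))
      (forLoop 14 (.const 0) (var 1)
        (.store 7 (var 11) (var 14) (.mul (var 17) (tab (var 14) (var 11))))))

/-- One round. -/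
def roundProg : Prog :=
  .seq loadVec
    (.seq (forLoop 12 (.add (var 11) (.const 1)) (var 1) pivotProg)
      (.seq loadVec
        (.seq (assign 12 (var 11))
          (.seq pivotProg (.seq storeVec emit)))))

/-- Set up the unit rows and the vector `y - x₀`. -/
def initUnit : Prog :=
  forLoop 13 (.const 0) (var 1)
    (.seq (.store 8 (var 13) (var 13) (.const 1))
      (.store 9 (var 13) (.const 0)
        (.sub (.read 5 (var 13) (.const 0)) (.read 4 (var 13) (.const 0)))))

/-- Set up the rows of `T` and the vector `T (y - x₀)`. -/
def initRows : Prog :=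
  forLoop 13 (.const 0) (var 0)
    (forLoop 14 (.const 0) (var 1)
      (.seq (.store 8 (.add (var 1) (var 13)) (var 14) (.read 2 (var 13) (var 14)))
        (.store 9 (.add (var 1) (var 13)) (.const 0)
          (.add (.read 9 (.add (var 1) (var 13)) (.const 0))
            (.mul (.read 2 (var 13) (var 14)) (.read 9 (var 14) (.const 0)))))))

/-- The decomposition algorithm. -/
def decomposeProg : Prog :=
  .seq initUnit (.seq initRows (forLoop 11 (.const 0) (var 1) roundProg))

/-- Time for `searchRow`, as a polynomial in a bound for `n + k + 1`; likewise below. -/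
def timeSearch {S : Type} [Semiring S] (X : S) : S := 100 + timeFor X 400

/-- Time for `saveRow`. -/
def timeSave {S : Type} [Semiring S] (X : S) : S := timeFor X 100 + (100 + 100)

/-- Time for `eliminate`. -/
def timeElim {S : Type} [Semiring S] (X : S) : S := timeFor X (100 + timeFor X 100)

/-- Time for `pivotProg`. -/
def timePivot {S : Type} [Semiring S] (X : S) : S := timeSearch X + (timeSave X + timeElim X)

/-- Time for `emit`. -/
def timeEmit {S : Type} [Semiring S] (X : S) : S := 200 + (100 + timeFor X 100)

/-- Time for `roundProg`. -/
def timeRound {S : Type} [Semiring S] (X : S) : S :=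
  timeFor X 100 + (timeFor X (timePivot X) + (timeFor X 100 + (100 +
    (timePivot X + (timeFor X 100 + timeEmit X)))))

/-- Time for `decomposeProg`. -/
def timeTotal {S : Type} [Semiring S] (X : S) : S :=
  timeFor X 200 + (timeFor X (timeFor X 200) + timeFor X (timeRound X))

variable {s : ℕ} {V : ℤ} {σ : Mem} {k n X : ℕ}

/-- The dimensions are stored, and fit the bounds. -/
structure Dims (σ : Mem) (k n X : ℕ) (V : ℤ) : Prop where
  hk : σ 0 0 0 = k
  hn : σ 1 0 0 = n
  hX : n + k + 1 ≤ X
  hV : (n + k + 1 : ℤ) ≤ V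

theorem Dims.frame {S : List ℕ} {σ' : Mem} (h : Dims σ k n X V) (hf : Frame S σ σ')
    (h0 : 0 ∉ S) (h1 : 1 ∉ S) : Dims σ' k n X V :=
  ⟨by rw [hf 0 h0, h.hk], by rw [hf 1 h1, h.hn], h.hX, h.hV⟩

theorem Dims.rowCount (h : Dims σ k n X V) : rowCount.eval σ = n + k := by
  simp [_root_.rowCount, h.hk, h.hn]

/-- Row `i` is in the support of column `c` and has least entry in column `n` there. -/
def IsArgmin (A : ℤ → ℤ → ℤ) (k n : ℕ) (c i : ℤ) : Prop :=
  0 ≤ i ∧ i < n + k ∧ A i c ≠ 0 ∧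
    ∀ j : ℤ, 0 ≤ j → j < n + k → A j c ≠ 0 → |A i n| ≤ |A j n|

theorem one_le_mul_self_iff_ne_zero (x : ℤ) : 1 ≤ x * x ↔ x ≠ 0 := by
  constructor
  · rintro h rfl; simp at h
  · intro h; have := mul_self_pos.mpr h; omega

theorem searchRow_wp (hR : Room s V) (hd : Dims σ k n X V)
    (hc : ∃ i : ℤ, 0 ≤ i ∧ i < n + k ∧ σ 8 i (σ 12 0 0) ≠ 0) :
    WP s V searchRow (timeSearch X) (fun σ' => Frame [13, 15] σ σ' ∧
      IsArgmin (σ 8) k n (σ 12 0 0) (σ' 15 0 0)) σ := by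
  obtain ⟨r, hr0, hr1, hr2⟩ := hc
  have hX := hd.hX
  have hV := hd.hV
  refine WP.seq (Q := fun σ' => Frame [13, 15] σ σ' ∧ σ' 15 0 0 = 0) (t := 100) ?_ ?_
  · refine WP.assign hR (by decide) le_rfl (fun _ => ?_) ⟨(Frame.refl _ _).write (by simp) _ _ _, ?_⟩
    · have := hR.1; simp; omega
    · simp [Mem.write_same]
  rintro σ₁ ⟨hf, h15⟩
  refine WP.forLoop hR (l := 0) (h := n + k) (fun i σ' => Frame [13, 15] σ σ' ∧
      (0 ≤ σ' 15 0 0 ∧ σ' 15 0 0 < n + k) ∧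
      ∀ j : ℤ, 0 ≤ j → j < i → σ 8 j (σ 12 0 0) ≠ 0 → σ 8 (σ' 15 0 0) (σ 12 0 0) ≠ 0 ∧
        |σ 8 (σ' 15 0 0) n| ≤ |σ 8 j n|)
    (by decide) (by decide) rfl (by omega) (by omega) le_rfl (by omega) ?_ ?_ ?_ ?_ ?_
  · exact ⟨hf, by omega, fun j h1 h2 => by omega⟩
  · rintro i σ' x ⟨h1, h2⟩
    refine ⟨h1.write (by simp) _ _ _, ?_⟩
    rw [Mem.write_of_ne _ (by decide)]
    exact h2
  · rintro i σ' ⟨h1, h2⟩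
    exact (hd.frame h1 (by decide) (by decide)).rowCount
  · rintro i σ' hi0 hi1 ⟨h1, h2, h3⟩ hv
    have hbd : Bounded V σ' → |(var 13).eval σ'| ≤ V := fun hb => hb _ _ _
    have e8 : σ' 8 = σ 8 := h1 8 (by decide)
    have e12 : σ' 12 = σ 12 := h1 12 (by decide)
    have e1 : σ' 1 0 0 = n := by rw [h1 1 (by decide), hd.hn]
    have hset : ∀ t, 100 ≤ t → (∀ j : ℤ, 0 ≤ j → j < i + 1 → σ 8 j (σ 12 0 0) ≠ 0 →
          σ 8 i (σ 12 0 0) ≠ 0 ∧ |σ 8 i n| ≤ |σ 8 j n|) →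
        WP s V (assign 15 (var 13)) t (fun σ'' => σ'' 13 0 0 = i ∧ Frame [13, 15] σ σ'' ∧
          (0 ≤ σ'' 15 0 0 ∧ σ'' 15 0 0 < n + k) ∧
          ∀ j : ℤ, 0 ≤ j → j < i + 1 → σ 8 j (σ 12 0 0) ≠ 0 →
            σ 8 (σ'' 15 0 0) (σ 12 0 0) ≠ 0 ∧ |σ 8 (σ'' 15 0 0) n| ≤ |σ 8 j n|) σ' := by
      intro t ht h
      refine WP.assign hR (by decide) ht hbd ⟨?_, h1.write (by simp) _ _ _, ?_⟩
      · rw [Mem.write_of_ne _ (by decide), hv]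
      · rw [Mem.write_same, eval_var, hv]
        exact ⟨⟨hi0, hi1⟩, h⟩
    have hsplit : ∀ j : ℤ, j < i + 1 → j < i ∨ j = i := fun j _ => by omega
    refine WP.ite (t := 300) hR (by decide) (by decide) (fun h4 => ?_) (fun h4 => ?_)
    · simp only [eval_const, Expr.sq, eval_mul, tab, eval_read, eval_var, hv, e8, e12,
        one_le_mul_self_iff_ne_zero] at h4
      refine WP.ite (t := 200) hR (by decide) (by decide) (fun h5 => ?_) (fun h5 => ?_)
      · simp only [eval_const, Expr.sq, eval_mul, tab, eval_read, eval_var, e8, e12,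
          one_le_mul_self_iff_ne_zero] at h5
        refine WP.ite (t := 100) hR (by decide) (by decide) (fun h6 => ?_) (fun h6 => ?_)
        · simp only [Expr.sq, eval_mul, tab, eval_read, eval_var, hv, e8, e1,
            ← abs_le_iff_mul_self_le] at h6
          refine WP.skip (by norm_num) ⟨hv, h1, h2, fun j j1 j2 j3 => ?_⟩
          rcases hsplit j j2 with h | rfl
          · exact h3 j j1 h j3
          · exact ⟨h5, h6⟩
        · simp only [Expr.sq, eval_mul, tab, eval_read, eval_var, hv, e8, e1,
            ← abs_le_iff_mul_self_le] at h6
          refine hset _ (by norm_num) fun j j1 j2 j3 => ⟨h4, ?_⟩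
          rcases hsplit j j2 with h | rfl
          · exact (not_le.mp h6).le.trans (h3 j j1 h j3).2
          · exact le_rfl
      · simp only [eval_const, Expr.sq, eval_mul, tab, eval_read, eval_var, e8, e12,
          one_le_mul_self_iff_ne_zero] at h5
        refine hset _ (by norm_num) fun j j1 j2 j3 => ⟨h4, ?_⟩
        rcases hsplit j j2 with h | rfl
        · exact absurd (h3 j j1 h j3).1 h5
        · exact le_rfl
    · simp only [eval_const, Expr.sq, eval_mul, tab, eval_read, eval_var, hv, e8, e12,
        one_le_mul_self_iff_ne_zero] at h4
      refine WP.skip (by norm_num) ⟨hv, h1, h2, fun j j1 j2 j3 => ?_⟩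
      rcases hsplit j j2 with h | rfl
      · exact h3 j j1 h j3
      · exact absurd j3 h4
  · rintro σ' ⟨h1, h2, h3⟩
    exact ⟨h1, h2.1, h2.2, (h3 r hr0 hr1 hr2).1, fun j j1 j2 j3 => (h3 j j1 j2 j3).2⟩

theorem saveRow_wp (hR : Room s V) (hd : Dims σ k n X V) (hc0 : 0 ≤ σ 12 0 0)
    (hc1 : σ 12 0 0 < n) (hbd : |σ 8 (σ 15 0 0) (σ 12 0 0) - 1| ≤ V) :
    WP s V saveRow (timeSave X) (fun σ' => Frame [10, 14, 16] σ σ' ∧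
      σ' 16 0 0 = σ 8 (σ 15 0 0) (σ 12 0 0) ∧
      ∀ j : ℤ, 0 ≤ j → j ≤ n →
        σ' 10 j 0 = σ 8 (σ 15 0 0) j - if j = σ 12 0 0 then 1 else 0) σ := by
  have hX := hd.hX
  have hV := hd.hV
  refine WP.seq (Q := fun σ' => Frame [10, 14, 16] σ σ' ∧
      ∀ j : ℤ, 0 ≤ j → j < n + 1 → σ' 10 j 0 = σ 8 (σ 15 0 0) j) ?_ ?_
  · refine WP.forLoop hR (l := 0) (h := n + 1) (fun i σ' => Frame [10, 14, 16] σ σ' ∧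
      ∀ j : ℤ, 0 ≤ j → j < i → σ' 10 j 0 = σ 8 (σ 15 0 0) j)
      (by decide) (by decide) rfl (by omega) (by omega) le_rfl (by omega) ?_ ?_ ?_ ?_ ?_
    · exact ⟨Frame.refl _ _, fun j h1 h2 => by omega⟩
    · rintro i σ' x ⟨h1, h2⟩
      refine ⟨h1.write (by simp) _ _ _, ?_⟩
      rw [Mem.write_of_ne _ (by decide)]
      exact h2
    · rintro i σ' ⟨h1, h2⟩
      simp [(hd.frame h1 (by decide) (by decide)).hn]
    · rintro i σ' hi0 hi1 ⟨h1, h2⟩ hv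
      refine WP.store hR (by decide) (by decide) (by decide) le_rfl (fun hb => hb _ _ _) ?_
      simp only [tab, eval_read, eval_var, eval_const, hv]
      refine ⟨?_, h1.write (by simp) _ _ _, fun j j1 j2 => ?_⟩
      · rw [Mem.write_of_ne _ (by decide), hv]
      · rw [Mem.write_apply, h1 8 (by decide), h1 15 (by decide)]
        split_ifs with h
        · rw [h.1]
        · exact h2 j j1 (by omega)
    · exact fun σ' h => h
  rintro σ₁ ⟨hf, h10⟩
  refine WP.seq (Q := fun σ' => Frame [10, 14, 16] σ σ' ∧
      ∀ j : ℤ, 0 ≤ j → j ≤ n →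
        σ' 10 j 0 = σ 8 (σ 15 0 0) j - if j = σ 12 0 0 then 1 else 0) (t := 100) ?_ ?_
  · have e12 : σ₁ 12 = σ 12 := hf 12 (by decide)
    refine WP.store hR (by decide) (by decide) (by decide) le_rfl (fun _ => ?_)
      ⟨hf.write (by simp) _ _ _, fun j j1 j2 => ?_⟩
    · simp only [eval_sub, eval_read, eval_var, eval_const, e12]
      rw [h10 _ hc0 (by omega)]
      exact hbd
    · simp only [eval_sub, eval_read, eval_var, eval_const, e12]
      rw [Mem.write_apply, h10 _ hc0 (by omega), h10 j j1 (by omega)]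
      by_cases h : j = σ 12 0 0 <;> simp [h]
  · rintro σ₂ ⟨hf2, h2⟩
    refine WP.assign hR (by decide) le_rfl (fun hb => hb _ _ _) ⟨hf2.write (by simp) _ _ _, ?_, ?_⟩
    · rw [Mem.write_same]
      simp only [tab, eval_read, eval_var]
      rw [hf2 8 (by decide), hf2 15 (by decide), hf2 12 (by decide)]
    · rw [Mem.write_of_ne _ (by decide)]
      exact h2

theorem eliminate_wp (hR : Room s V) (hd : Dims σ k n X V) (hc0 : 0 ≤ σ 12 0 0)
    (hc1 : σ 12 0 0 < n)
    (hg : ∀ i : ℤ, 0 ≤ i → i < n + k → |σ 8 i (σ 12 0 0) * σ 16 0 0| ≤ V)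
    (hbd : ∀ i j : ℤ, 0 ≤ i → i < n + k → 0 ≤ j → j ≤ n →
      |σ 8 i j - σ 8 i (σ 12 0 0) * σ 16 0 0 * σ 10 j 0| ≤ V) :
    WP s V eliminate (timeElim X) (fun σ' => Frame [8, 13, 14, 17] σ σ' ∧
      ∀ i j : ℤ, 0 ≤ i → i < n + k → 0 ≤ j → j ≤ n →
        σ' 8 i j = σ 8 i j - σ 8 i (σ 12 0 0) * σ 16 0 0 * σ 10 j 0) σ := by
  have hX := hd.hX
  have hV := hd.hV
  refine WP.forLoop hR (l := 0) (h := n + k) (fun r σ' => Frame [8, 13, 14, 17] σ σ' ∧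
      (∀ i j : ℤ, 0 ≤ i → i < r → 0 ≤ j → j ≤ n →
        σ' 8 i j = σ 8 i j - σ 8 i (σ 12 0 0) * σ 16 0 0 * σ 10 j 0) ∧
      ∀ i j : ℤ, r ≤ i → σ' 8 i j = σ 8 i j)
    (by decide) (by decide) rfl (by omega) (by omega) le_rfl (by omega) ?_ ?_ ?_ ?_ ?_
  · exact ⟨Frame.refl _ _, fun i j h1 h2 => by omega, fun _ _ _ => rfl⟩
  · rintro i σ' x ⟨h1, h2⟩
    refine ⟨h1.write (by simp) _ _ _, ?_⟩
    rw [Mem.write_of_ne _ (by decide)]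
    exact h2
  · rintro i σ' ⟨h1, h2⟩
    exact (hd.frame h1 (by decide) (by decide)).rowCount
  · rintro r σ₁ hr0 hr1 ⟨hf1, hdone, hold⟩ hv1
    refine WP.seq (Q := fun σ' => Frame [8, 13, 14, 17] σ σ' ∧ σ' 8 = σ₁ 8 ∧ σ' 13 0 0 = r ∧
      σ' 17 0 0 = σ 8 r (σ 12 0 0) * σ 16 0 0) (t := 100) ?_ ?_
    · have hev : (Expr.mul (tab (var 13) (var 12)) (var 16)).eval σ₁
          = σ 8 r (σ 12 0 0) * σ 16 0 0 := by
        simp only [eval_mul, tab, eval_read, eval_var, hv1]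
        rw [hold _ _ le_rfl, hf1 12 (by decide), hf1 16 (by decide)]
      refine WP.assign hR (by decide) le_rfl (fun _ => ?_) ⟨hf1.write (by simp) _ _ _, ?_, ?_, ?_⟩
      · rw [hev]; exact hg r hr0 hr1
      · rw [Mem.write_of_ne _ (by decide)]
      · rw [Mem.write_of_ne _ (by decide), hv1]
      · rw [Mem.write_same, hev]
    rintro σ₂ ⟨hf2, h8, h13, h17⟩
    refine WP.forLoop hR (l := 0) (h := n + 1) (fun c σ' => Frame [8, 13, 14, 17] σ σ' ∧
        σ' 13 0 0 = r ∧ σ' 17 0 0 = σ 8 r (σ 12 0 0) * σ 16 0 0 ∧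
        (∀ j : ℤ, 0 ≤ j → j < c →
          σ' 8 r j = σ 8 r j - σ 8 r (σ 12 0 0) * σ 16 0 0 * σ 10 j 0) ∧
        (∀ j : ℤ, c ≤ j → σ' 8 r j = σ 8 r j) ∧ ∀ i j : ℤ, i ≠ r → σ' 8 i j = σ₁ 8 i j)
      (by decide) (by decide) rfl (by omega) (by omega) le_rfl (by omega) ?_ ?_ ?_ ?_ ?_
    · exact ⟨hf2, h13, h17, fun j h1 h2 => by omega, fun j _ => by rw [h8, hold _ _ le_rfl],
        fun i j _ => by rw [h8]⟩
    · rintro c σ' x ⟨h1, h2⟩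
      refine ⟨h1.write (by simp) _ _ _, ?_⟩
      rw [Mem.write_of_ne _ (by decide), Mem.write_of_ne _ (by decide),
        Mem.write_of_ne _ (by decide)]
      exact h2
    · rintro c σ' ⟨h1, h2⟩
      simp [(hd.frame h1 (by decide) (by decide)).hn]
    · rintro c σ' hi0 hi1 ⟨h1, h2, h3, h4, h5, h6⟩ hv
      have hev : (Expr.sub (tab (var 13) (var 14))
          (.mul (var 17) (.read 10 (var 14) (.const 0)))).eval σ'
            = σ 8 r c - σ 8 r (σ 12 0 0) * σ 16 0 0 * σ 10 c 0 := by
        simp only [eval_sub, eval_mul, tab, eval_read, eval_var, eval_const, h2, h3, hv]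
        rw [h5 _ le_rfl, h1 10 (by decide)]
      refine WP.store hR (by decide) (by decide) (by decide) le_rfl (fun hb => ?_) ?_
      · rw [hev]; exact hbd r c hr0 hr1 hi0 (by omega)
      rw [hev]
      simp only [eval_var, hv, h2]
      refine ⟨?_, h1.write (by simp) _ _ _, ?_, ?_, fun j j1 j2 => ?_, fun j j1 => ?_,
        fun i j hi => ?_⟩
      · rw [Mem.write_of_ne _ (by decide), hv]
      · rw [Mem.write_of_ne _ (by decide), h2]
      · rw [Mem.write_of_ne _ (by decide), h3]
      · rw [Mem.write_apply]
        split_ifs with h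
        · rw [h.2]
        · exact h4 j j1 (by omega)
      · rw [Mem.write_apply, if_neg (by omega)]
        exact h5 j (by omega)
      · rw [Mem.write_apply, if_neg (by tauto)]
        exact h6 i j hi
    · rintro σ' ⟨h1, h2, h3, h4, h5, h6⟩
      refine ⟨h2, h1, fun i j i1 i2 j1 j2 => ?_, fun i j i1 => ?_⟩
      · by_cases hir : i = r
        · rw [hir]; exact h4 j j1 (by omega)
        · rw [h6 i j hir]; exact hdone i j i1 (by omega) j1 j2
      · rw [h6 i j (by omega)]; exact hold i j (by omega)
  · exact fun σ' h => ⟨h.1, fun i j h1 h2 h3 h4 => h.2.1 i j h1 h2 h3 h4⟩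

/-- The array after an exchange step with pivot row `i₀` and column `c`. -/
def pivotArr (A : ℤ → ℤ → ℤ) (c i₀ : ℤ) : ℤ → ℤ → ℤ :=
  fun i j => A i j - A i c * A i₀ c * (A i₀ j - if j = c then 1 else 0)

theorem pivotProg_wp (hR : Room s V) (hd : Dims σ k n X V) (hc0 : 0 ≤ σ 12 0 0)
    (hc1 : σ 12 0 0 < n) (hc : ∃ i : ℤ, 0 ≤ i ∧ i < n + k ∧ σ 8 i (σ 12 0 0) ≠ 0)
    (hunit : ∀ i : ℤ, 0 ≤ i → i < n + k → |σ 8 i (σ 12 0 0)| ≤ 1)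
    (hbd : ∀ i₀, IsArgmin (σ 8) k n (σ 12 0 0) i₀ → ∀ i j : ℤ, 0 ≤ i → i < n + k → 0 ≤ j →
      j ≤ n → |pivotArr (σ 8) (σ 12 0 0) i₀ i j| ≤ V) :
    WP s V pivotProg (timePivot X) (fun σ' => Frame [8, 10, 13, 14, 15, 16, 17] σ σ' ∧
      ∃ i₀, IsArgmin (σ 8) k n (σ 12 0 0) i₀ ∧ σ' 10 n 0 = σ 8 i₀ n ∧
      ∀ i j : ℤ, 0 ≤ i → i < n + k → 0 ≤ j → j ≤ n →
        σ' 8 i j = pivotArr (σ 8) (σ 12 0 0) i₀ i j) σ := by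
  have hV2 := hR.1
  refine WP.seq (searchRow_wp hR hd hc) ?_
  rintro σ₁ ⟨hf1, hi₀⟩
  have e8 : σ₁ 8 = σ 8 := hf1 8 (by decide)
  have e12 : σ₁ 12 = σ 12 := hf1 12 (by decide)
  have hd1 := hd.frame hf1 (by decide) (by decide)
  have hu0 := abs_le.mp (hunit _ hi₀.1 hi₀.2.1)
  refine WP.seq (saveRow_wp hR hd1 (by rwa [e12]) (by rwa [e12]) ?_) ?_
  · rw [e8, e12, abs_le]; omega
  rintro σ₂ ⟨hf2, h16, h10⟩
  rw [e8, e12] at h16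
  rw [e8, e12] at h10
  have e8' : σ₂ 8 = σ 8 := by rw [hf2 8 (by decide), e8]
  have e12' : σ₂ 12 = σ 12 := by rw [hf2 12 (by decide), e12]
  refine (eliminate_wp hR (hd1.frame hf2 (by decide) (by decide)) (by rwa [e12'])
    (by rwa [e12']) ?_ ?_).mono le_rfl ?_
  · intro i h1 h2
    rw [e8', e12', h16, abs_mul]
    have hu := hunit i h1 h2
    have hu' := hunit _ hi₀.1 hi₀.2.1
    have := mul_le_mul hu hu' (abs_nonneg _) zero_le_one
    omega
  · intro i j h1 h2 h3 h4
    rw [e8', e12', h16, h10 j h3 h4]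
    exact hbd _ hi₀ i j h1 h2 h3 h4
  · rintro σ' ⟨hf3, h8⟩
    refine ⟨(hf1.trans hf2 (S'' := [8, 10, 13, 14, 15, 16, 17]) (by simp) (by simp)).trans hf3
      (by simp) (by simp), _, hi₀, ?_, fun i j h1 h2 h3 h4 => ?_⟩
    · rw [hf3 10 (by decide), h10 n (by omega) le_rfl, if_neg (by omega), sub_zero]
    · rw [h8 i j h1 h2 h3 h4, e8', e12', h16, h10 j h3 h4]; rfl

theorem loadVec_wp (hR : Room s V) (hd : Dims σ k n X V) :
    WP s V loadVec (timeFor X 100) (fun σ' => Frame [8, 13] σ σ' ∧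
      (∀ i : ℤ, 0 ≤ i → i < n + k → σ' 8 i n = σ 9 i 0) ∧
      ∀ i j : ℤ, j ≠ n → σ' 8 i j = σ 8 i j) σ := by
  have hX := hd.hX
  have hV := hd.hV
  refine WP.forLoop hR (l := 0) (h := n + k) (fun r σ' => Frame [8, 13] σ σ' ∧
      (∀ i : ℤ, 0 ≤ i → i < r → σ' 8 i n = σ 9 i 0) ∧
      ∀ i j : ℤ, j ≠ n → σ' 8 i j = σ 8 i j)
    (by decide) (by decide) rfl (by omega) (by omega) le_rfl (by omega) ?_ ?_ ?_ ?_ ?_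
  · exact ⟨Frame.refl _ _, fun i h1 h2 => by omega, fun _ _ _ => rfl⟩
  · rintro i σ' x ⟨h1, h2⟩
    refine ⟨h1.write (by simp) _ _ _, ?_⟩
    rw [Mem.write_of_ne _ (by decide)]
    exact h2
  · rintro i σ' ⟨h1, h2⟩
    exact (hd.frame h1 (by decide) (by decide)).rowCount
  · rintro r σ' hr0 hr1 ⟨h1, h2, h3⟩ hv
    refine WP.store hR (by decide) (by decide) (by decide) le_rfl (fun hb => hb _ _ _) ?_
    simp only [eval_read, eval_var, eval_const, hv, (hd.frame h1 (by decide) (by decide)).hn]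
    refine ⟨?_, h1.write (by simp) _ _ _, fun i i1 i2 => ?_, fun i j hj => ?_⟩
    · rw [Mem.write_of_ne _ (by decide), hv]
    · rw [Mem.write_apply, h1 9 (by decide)]
      split_ifs with h
      · rw [h.1]
      · exact h2 i i1 (by omega)
    · rw [Mem.write_apply, if_neg (by tauto)]
      exact h3 i j hj
  · exact fun σ' h => h

theorem storeVec_wp (hR : Room s V) (hd : Dims σ k n X V) :
    WP s V storeVec (timeFor X 100) (fun σ' => Frame [9, 13] σ σ' ∧
      ∀ i : ℤ, 0 ≤ i → i < n + k → σ' 9 i 0 = σ 8 i n) σ := by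
  have hX := hd.hX
  have hV := hd.hV
  refine WP.forLoop hR (l := 0) (h := n + k) (fun r σ' => Frame [9, 13] σ σ' ∧
      ∀ i : ℤ, 0 ≤ i → i < r → σ' 9 i 0 = σ 8 i n)
    (by decide) (by decide) rfl (by omega) (by omega) le_rfl (by omega) ?_ ?_ ?_ ?_ ?_
  · exact ⟨Frame.refl _ _, fun i h1 h2 => by omega⟩
  · rintro i σ' x ⟨h1, h2⟩
    refine ⟨h1.write (by simp) _ _ _, ?_⟩
    rw [Mem.write_of_ne _ (by decide)]
    exact h2
  · rintro i σ' ⟨h1, h2⟩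
    exact (hd.frame h1 (by decide) (by decide)).rowCount
  · rintro r σ' hr0 hr1 ⟨h1, h2⟩ hv
    refine WP.store hR (by decide) (by decide) (by decide) le_rfl (fun hb => hb _ _ _) ?_
    simp only [tab, eval_read, eval_var, eval_const, hv,
      (hd.frame h1 (by decide) (by decide)).hn]
    refine ⟨?_, h1.write (by simp) _ _ _, fun i i1 i2 => ?_⟩
    · rw [Mem.write_of_ne _ (by decide), hv]
    · rw [Mem.write_apply, h1 8 (by decide)]
      split_ifs with h
      · rw [h.1]
      · exact h2 i i1 (by omega)
  · exact fun σ' h => h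

theorem emit_wp (hR : Room s V) (hd : Dims σ k n X V) :
    WP s V emit (timeEmit X) (fun σ' => Frame [6, 7, 14, 17] σ σ' ∧
      ∃ g : ℤ, (g = 1 ∨ g = -1) ∧ g * σ 10 n 0 = |σ 10 n 0| ∧
      σ' 6 (σ 11 0 0) 0 = |σ 10 n 0| ∧ (∀ i : ℤ, i ≠ σ 11 0 0 → σ' 6 i 0 = σ 6 i 0) ∧
      (∀ j : ℤ, 0 ≤ j → j < n → σ' 7 (σ 11 0 0) j = g * σ 8 j (σ 11 0 0)) ∧
      ∀ i j : ℤ, i ≠ σ 11 0 0 → σ' 7 i j = σ 7 i j) σ := by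
  have hX := hd.hX
  have hV := hd.hV
  have hV2 := hR.1
  refine WP.seq (Q := fun σ' => Frame [17] σ σ' ∧
      (σ' 17 0 0 = 1 ∨ σ' 17 0 0 = -1) ∧ σ' 17 0 0 * σ 10 n 0 = |σ 10 n 0|) (t := 200) ?_ ?_
  · refine WP.ite (t := 100) hR (by decide) (by decide) (fun h => ?_) (fun h => ?_)
    · simp only [eval_const, eval_read, eval_var, hd.hn] at h
      refine WP.assign hR (by decide) le_rfl (fun _ => by simp; omega)
        ⟨(Frame.refl _ _).write (by simp) _ _ _, ?_⟩
      rw [Mem.write_same]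
      simp [abs_of_nonneg h]
    · simp only [eval_const, eval_read, eval_var, hd.hn] at h
      refine WP.assign hR (by decide) le_rfl (fun _ => by simp; omega)
        ⟨(Frame.refl _ _).write (by simp) _ _ _, ?_⟩
      rw [Mem.write_same]
      simp [abs_of_neg (not_le.mp h)]
  rintro σ₁ ⟨hf1, hg, hgv⟩
  have hd1 := hd.frame hf1 (by decide) (by decide)
  refine WP.seq (Q := fun σ' => Frame [6, 17] σ σ' ∧ σ' 17 = σ₁ 17 ∧
      σ' 6 (σ 11 0 0) 0 = |σ 10 n 0| ∧ ∀ i : ℤ, i ≠ σ 11 0 0 → σ' 6 i 0 = σ 6 i 0) (t := 100) ?_ ?_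
  · have hev : (Expr.mul (var 17) (.read 10 (var 1) (.const 0))).eval σ₁ = |σ 10 n 0| := by
      simp only [eval_mul, eval_read, eval_var, eval_const, hd1.hn]
      rw [hf1 10 (by decide), hgv]
    refine WP.store hR (by decide) (by decide) (by decide) le_rfl (fun hb => ?_) ?_
    · rw [hev, abs_abs, ← hf1 10 (by decide)]; exact hb _ _ _
    rw [hev]
    simp only [eval_var, eval_const]
    rw [hf1 11 (by decide)]
    refine ⟨(hf1.trans (Frame.refl [6] _) (by simp) (by simp)).write (by simp) _ _ _,
      Mem.write_of_ne _ (by decide) _ _ _, Mem.write_same _ _ _ _ _, fun i hi => ?_⟩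
    rw [Mem.write_apply, if_neg (by tauto), hf1 6 (by decide)]
  rintro σ₂ ⟨hf2, h17, h6, h6'⟩
  refine WP.forLoop hR (l := 0) (h := n) (fun r σ' => Frame [6, 7, 14, 17] σ σ' ∧
      σ' 17 = σ₁ 17 ∧ σ' 6 = σ₂ 6 ∧
      (∀ j : ℤ, 0 ≤ j → j < r → σ' 7 (σ 11 0 0) j = σ₁ 17 0 0 * σ 8 j (σ 11 0 0)) ∧
      ∀ i j : ℤ, i ≠ σ 11 0 0 → σ' 7 i j = σ 7 i j)
    (by decide) (by decide) rfl (by omega) (by omega) le_rfl (by omega) ?_ ?_ ?_ ?_ ?_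
  · exact ⟨hf2.trans (Frame.refl [] _) (by simp) (by simp), h17, rfl, fun i h1 h2 => by omega,
      fun i j _ => by rw [hf2 7 (by decide)]⟩
  · rintro i σ' x ⟨h1, h2⟩
    refine ⟨h1.write (by simp) _ _ _, ?_⟩
    rw [Mem.write_of_ne _ (by decide), Mem.write_of_ne _ (by decide),
      Mem.write_of_ne _ (by decide)]
    exact h2
  · rintro i σ' ⟨h1, h2⟩
    exact (hd.frame h1 (by decide) (by decide)).hn
  · rintro r σ' hr0 hr1 ⟨h1, h2, h3, h4, h5⟩ hv
    have hev : (Expr.mul (var 17) (tab (var 14) (var 11))).eval σ'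
        = σ₁ 17 0 0 * σ 8 r (σ 11 0 0) := by
      simp only [eval_mul, tab, eval_read, eval_var, hv]
      rw [h2, h1 8 (by decide), h1 11 (by decide)]
    refine WP.store hR (by decide) (by decide) (by decide) le_rfl (fun hb => ?_) ?_
    · rw [hev, abs_mul, ← h1 8 (by decide)]
      have : |σ₁ 17 0 0| = 1 := by rcases hg with h | h <;> simp [h]
      rw [this, one_mul]
      exact hb _ _ _
    rw [hev]
    simp only [eval_var, hv]
    rw [h1 11 (by decide)]
    refine ⟨?_, h1.write (by simp) _ _ _, ?_, ?_, fun j j1 j2 => ?_, fun i j hi => ?_⟩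
    · rw [Mem.write_of_ne _ (by decide), hv]
    · rw [Mem.write_of_ne _ (by decide), h2]
    · rw [Mem.write_of_ne _ (by decide), h3]
    · rw [Mem.write_apply]
      split_ifs with h
      · rw [h.2]
      · exact h4 j j1 (by omega)
    · rw [Mem.write_apply, if_neg (by tauto)]
      exact h5 i j hi
  · rintro σ' ⟨h1, h2, h3, h4, h5⟩
    exact ⟨h1, _, hg, hgv, by rw [h3, h6], fun i hi => by rw [h3, h6' i hi], h4, h5⟩

end Program

section Refinement

variable {s : ℕ} {V : ℤ} {σ : Mem} {k n X : ℕ}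

/-- The array `A` holds the matrix `N`, with the additional column `w`. -/
def HoldsTableau (A : ℤ → ℤ → ℤ) (N : Matrix (Fin (n + k)) (Fin n) ℤ) (w : Fin (n + k) → ℤ) : Prop :=
  ∀ i : Fin (n + k), (∀ j : Fin n, A (i : ℕ) (j : ℕ) = N i j) ∧ A (i : ℕ) n = w i

theorem exists_fin_cast {m : ℕ} {i : ℤ} (h0 : 0 ≤ i) (h1 : i < m) : ∃ a : Fin m, ((a : ℕ) : ℤ) = i :=
  ⟨⟨i.toNat, by omega⟩, by simp [h0]⟩

theorem HoldsTableau.isRatioRow {A : ℤ → ℤ → ℤ} {N : Matrix (Fin (n + k)) (Fin n) ℤ}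
    {w : Fin (n + k) → ℤ} (h : HoldsTableau A N w) {c : Fin n} {i : ℤ}
    (hi : IsArgmin A k n (c : ℕ) i) : ∃ a : Fin (n + k), ((a : ℕ) : ℤ) = i ∧ IsRatioRow N w c a := by
  obtain ⟨h0, h1, h2, h3⟩ := hi
  obtain ⟨a, rfl⟩ := exists_fin_cast (m := n + k) h0 (by push_cast; exact h1)
  refine ⟨a, rfl, ?_, fun j hj => ?_⟩
  · rwa [← (h a).1]
  · have := h3 (j : ℕ) (by omega) (by omega) (by rwa [(h j).1])
    rwa [(h a).2, (h j).2] at this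

theorem HoldsTableau.pivotArr_left {A : ℤ → ℤ → ℤ} {N : Matrix (Fin (n + k)) (Fin n) ℤ}
    {w : Fin (n + k) → ℤ} (h : HoldsTableau A N w) (c a : Fin n) (i j : Fin (n + k)) :
    pivotArr A (c : ℕ) (i : ℕ) (j : ℕ) (a : ℕ) = pivotMat N c i j a := by
  have : ((a : ℕ) : ℤ) = (c : ℕ) ↔ a = c := by rw [Nat.cast_inj, Fin.val_inj]
  simp only [pivotArr, pivotMat, Matrix.of_apply, (h _).1, this]

theorem HoldsTableau.pivotArr_right {A : ℤ → ℤ → ℤ} {N : Matrix (Fin (n + k)) (Fin n) ℤ}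
    {w : Fin (n + k) → ℤ} (h : HoldsTableau A N w) (c : Fin n) (i j : Fin (n + k)) :
    pivotArr A (c : ℕ) (i : ℕ) (j : ℕ) n = pivotVec N c i w j := by
  have : ((n : ℕ) : ℤ) ≠ (c : ℕ) := by have := c.2; omega
  simp only [pivotArr, pivotVec, (h _).1, (h _).2, if_neg this, sub_zero]

theorem pivotProg_refines (hR : Room s V) (hd : Dims σ k n X V) {c : Fin n}
    (hc : σ 12 0 0 = (c : ℕ)) {N : Matrix (Fin (n + k)) (Fin n) ℤ} {w : Fin (n + k) → ℤ}
    (hrep : HoldsTableau (σ 8) N w) (hN : ∀ i, |N i c| ≤ 1) (hne : ∃ i, N i c ≠ 0)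
    (hbd : ∀ i, IsRatioRow N w c i → ∀ j, (∀ a, |pivotMat N c i j a| ≤ V) ∧
      |pivotVec N c i w j| ≤ V) :
    WP s V pivotProg (timePivot X) (fun σ' => Frame [8, 10, 13, 14, 15, 16, 17] σ σ' ∧
      ∃ i, IsRatioRow N w c i ∧ σ' 10 n 0 = w i ∧
        HoldsTableau (σ' 8) (pivotMat N c i) (pivotVec N c i w)) σ := by
  have hc2 := c.2
  refine (pivotProg_wp hR hd (by omega) (by omega) ?_ ?_ ?_).mono le_rfl ?_
  · obtain ⟨i, hi⟩ := hne
    exact ⟨(i : ℕ), by omega, by omega, by rwa [hc, (hrep i).1]⟩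
  · intro i h0 h1
    obtain ⟨a, rfl⟩ := exists_fin_cast (m := n + k) h0 (by push_cast; exact h1)
    rw [hc, (hrep a).1]
    exact hN a
  · intro i₀ hi₀ i j h1 h2 h3 h4
    rw [hc] at hi₀ ⊢
    obtain ⟨r, rfl, hr⟩ := hrep.isRatioRow hi₀
    obtain ⟨a, rfl⟩ := exists_fin_cast (m := n + k) h1 (by push_cast; exact h2)
    rcases h4.lt_or_eq with h4 | rfl
    · obtain ⟨b, rfl⟩ := exists_fin_cast h3 h4
      rw [hrep.pivotArr_left]
      exact (hbd r hr a).1 b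
    · rw [hrep.pivotArr_right]
      exact (hbd r hr a).2
  · rintro σ' ⟨hf, i₀, hi₀, h10, h8⟩
    rw [hc] at hi₀ h8
    obtain ⟨r, rfl, hr⟩ := hrep.isRatioRow hi₀
    refine ⟨hf, r, hr, by rw [h10, (hrep r).2], fun i => ⟨fun j => ?_, ?_⟩⟩
    · rw [h8 _ _ (by omega) (by omega) (by omega) (by omega), hrep.pivotArr_left]
    · rw [h8 _ _ (by omega) (by omega) (by omega) le_rfl, hrep.pivotArr_right]

theorem IsTableau.abs_entry_le {m : ℕ} {M N : Matrix (Fin m) (Fin n) ℤ} {R : Fin n → Fin m}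
    (h : IsTableau M R N) (hM : ∀ j, UnimodularWith M (M j)) (j : Fin m) (c : Fin n) :
    |N j c| ≤ 1 := by
  rcases h.entry_mem hM j c with h | h | h <;> simp [h]

/-- The treatment of the columns after `p` in round `p`. -/
theorem innerLoop_wp {M : Matrix (Fin (n + k)) (Fin n) ℤ} (hM : ∀ j, UnimodularWith M (M j))
    (hR : Room s V) (hd : Dims σ k n X V) {U : ℤ} (hU : n * U ≤ V) {p : Fin n}
    (hp : σ 11 0 0 = (p : ℕ)) {R : Fin n → Fin (n + k)} {N : Matrix (Fin (n + k)) (Fin n) ℤ}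
    {u : Fin (n + k) → ℤ} (hu : OuterInv M U p R N u) (hrep : HoldsTableau (σ 8) N u) :
    WP s V (forLoop 12 (.add (var 11) (.const 1)) (var 1) pivotProg) (timeFor X (timePivot X))
      (fun σ' => Frame [8, 10, 12, 13, 14, 15, 16, 17] σ σ' ∧ ∃ R N w,
        InnerInv M U p u n R N w ∧ HoldsTableau (σ' 8) N w) σ := by
  have hX := hd.hX
  have hV := hd.hV
  have hV2 := hR.1
  have hp2 := p.2
  refine WP.forLoop hR (l := p + 1) (h := n)
    (fun c σ' => Frame [8, 10, 12, 13, 14, 15, 16, 17] σ σ' ∧ ∃ R N w,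
        InnerInv M U p u c.toNat R N w ∧ HoldsTableau (σ' 8) N w)
    (by decide) (by decide) (by simp [hp]) (by omega) (by omega) (by omega) (by omega) ?_ ?_ ?_ ?_ ?_
  · exact ⟨Frame.refl _ _, R, N, u, hu.toInner, hrep⟩
  · rintro i σ' x ⟨h1, h2⟩
    refine ⟨h1.write (by simp) _ _ _, ?_⟩
    rw [Mem.write_of_ne _ (by decide)]
    exact h2
  · rintro i σ' ⟨h1, h2⟩
    exact (hd.frame h1 (by decide) (by decide)).hn
  · rintro i σ₁ hi0 hi1 ⟨hf, R₁, N₁, w₁, hinv, hrep₁⟩ hv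
    obtain ⟨c, rfl⟩ := exists_fin_cast (by omega) hi1
    have hpc : p < c := by rw [Fin.lt_def]; omega
    rw [Int.toNat_natCast] at hinv
    have htab := hinv.outer.tab
    refine (pivotProg_refines hR (hd.frame hf (by decide) (by decide)) hv hrep₁
      (fun j => htab.abs_entry_le hM j c) (htab.exists_ne_zero c) ?_).mono le_rfl ?_
    · intro r hr j
      have hstep := hinv.step hM hpc hr
      exact ⟨fun a => (hstep.outer.tab.abs_entry_le hM j a).trans (by omega),
        (hstep.abs_le hM j).trans hU⟩
    · rintro σ' ⟨hf', r, hr, -, hrep'⟩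
      refine ⟨by rw [hf' 12 (by decide), hv], hf.trans hf' (by simp) (by simp),
        Function.update R₁ c r, _, _,
        ?_, hrep'⟩
      have : ((c : ℕ) + 1 : ℤ).toNat = c + 1 := by omega
      rw [this]
      exact hinv.step hM hpc hr
  · rintro σ' ⟨h1, R', N', w', h2, h3⟩
    exact ⟨h1, R', N', w', by simpa using h2, h3⟩

/-- The first `p` terms of the decomposition have been found, and `u` remains. -/
structure History (T : Matrix (Fin k) (Fin n) ℤ) (u₀ : Fin (n + k) → ℤ) (p : ℕ)
    (u : Fin (n + k) → ℤ) (lam : Fin n → ℤ) (Y : Fin n → Fin n → ℤ) : Prop where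
  conform : ∀ j, SignConform (u j) (u₀ j)
  nonneg : ∀ q : Fin n, (q : ℕ) < p → 0 ≤ lam q
  elementary : ∀ q : Fin n, (q : ℕ) < p → IsElementary T (Y q)
  term : ∀ q : Fin n, (q : ℕ) < p → ∀ j, SignConform (lam q * (stacked T *ᵥ Y q) j) (u₀ j)
  sum : ∀ j, u₀ j = u j + ∑ q : Fin n, if (q : ℕ) < p then lam q * (stacked T *ᵥ Y q) j else 0

theorem History.step {T : Matrix (Fin k) (Fin n) ℤ} {u₀ u u' : Fin (n + k) → ℤ} {p : Fin n}
    {lam lam' : Fin n → ℤ} {Y Y' : Fin n → Fin n → ℤ} (h : History T u₀ p u lam Y)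
    (hlam : ∀ q, q ≠ p → lam' q = lam q) (hY : ∀ q, q ≠ p → Y' q = Y q) (h0 : 0 ≤ lam' p)
    (hel : IsElementary T (Y' p))
    (hu : ∀ j, u j = u' j + lam' p * (stacked T *ᵥ Y' p) j ∧
      SignConform (lam' p * (stacked T *ᵥ Y' p) j) (u j) ∧ SignConform (u' j) (u j)) :
    History T u₀ (p + 1) u' lam' Y' := by
  have hcase : ∀ q : Fin n, (q : ℕ) < p + 1 → q = p ∨ (q ≠ p ∧ (q : ℕ) < p) := fun q hq => by
    rcases eq_or_ne q p with h | h
    · exact Or.inl h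
    · exact Or.inr ⟨h, lt_of_le_of_ne (by omega) fun h' => h (Fin.ext h')⟩
  refine ⟨fun j => (hu j).2.2.trans (h.conform j), fun q hq => ?_, fun q hq => ?_,
    fun q hq j => ?_, fun j => ?_⟩
  · rcases hcase q hq with rfl | ⟨h1, h2⟩
    · exact h0
    · rw [hlam q h1]; exact h.nonneg q h2
  · rcases hcase q hq with rfl | ⟨h1, h2⟩
    · exact hel
    · rw [hY q h1]; exact h.elementary q h2
  · rcases hcase q hq with rfl | ⟨h1, h2⟩
    · exact (hu j).2.1.trans (h.conform j)
    · rw [hlam q h1, hY q h1]; exact h.term q h2 j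
  · have hterm : ∀ q : Fin n, (if (q : ℕ) < p + 1 then lam' q * (stacked T *ᵥ Y' q) j else 0)
        = (if (q : ℕ) < p then lam q * (stacked T *ᵥ Y q) j else 0)
          + if q = p then lam' p * (stacked T *ᵥ Y' p) j else 0 := fun q => by
      by_cases hq : q = p
      · subst hq; simp
      · have h1 : (q : ℕ) < p + 1 ↔ (q : ℕ) < p :=
          ⟨fun h => ((hcase q h).resolve_left hq).2, fun h => by omega⟩
        simp only [h1, hq, if_false, add_zero, hlam q hq, hY q hq]
    simp only [hterm, Finset.sum_add_distrib, Finset.sum_ite_eq', Finset.mem_univ, if_true]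
    rw [h.sum j, (hu j).1]
    ring

/-- Invariant of the main loop. -/
def RoundInv (T : Matrix (Fin k) (Fin n) ℤ) (U : ℤ) (u₀ : Fin (n + k) → ℤ) (p : ℕ) (σ : Mem) :
    Prop :=
  ∃ R N u, OuterInv (stacked T) U p R N u ∧
    (∀ (i : Fin (n + k)) (j : Fin n), σ 8 (i : ℕ) (j : ℕ) = N i j) ∧
    (∀ i : Fin (n + k), σ 9 (i : ℕ) 0 = u i) ∧
    History T u₀ p u (fun q => σ 6 (q : ℕ) 0) (fun q j => σ 7 (q : ℕ) (j : ℕ))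

theorem loadVec_refines (hR : Room s V) (hd : Dims σ k n X V)
    {N : Matrix (Fin (n + k)) (Fin n) ℤ} {u : Fin (n + k) → ℤ}
    (h8 : ∀ (i : Fin (n + k)) (j : Fin n), σ 8 (i : ℕ) (j : ℕ) = N i j)
    (h9 : ∀ i : Fin (n + k), σ 9 (i : ℕ) 0 = u i) :
    WP s V loadVec (timeFor X 100) (fun σ' => Frame [8, 13] σ σ' ∧ HoldsTableau (σ' 8) N u) σ := by
  refine (loadVec_wp hR hd).mono le_rfl ?_
  rintro σ' ⟨h1, h2, h3⟩
  refine ⟨h1, fun i => ⟨fun j => ?_, ?_⟩⟩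
  · rw [h3 _ _ (by omega), h8]
  · rw [h2 _ (by omega) (by omega), h9]

theorem roundProg_wp {T : Matrix (Fin k) (Fin n) ℤ} (hT : T.IsTotallyUnimodular)
    (hR : Room s V) (hd : Dims σ k n X V) {U : ℤ} (hU : n * U ≤ V) (hUV : U ≤ V) {p : Fin n}
    (hp : σ 11 0 0 = (p : ℕ)) {u₀ : Fin (n + k) → ℤ} (h : RoundInv T U u₀ p σ) :
    WP s V roundProg (timeRound X)
      (fun σ' => Frame [6, 7, 8, 9, 10, 12, 13, 14, 15, 16, 17] σ σ' ∧
        RoundInv T U u₀ (p + 1) σ') σ := by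
  have hM := unimodularWith_row hT
  have hV2 := hR.1
  obtain ⟨R, N, u, hout, h8, h9, hhist⟩ := h
  refine WP.seq (loadVec_refines hR hd h8 h9) ?_
  rintro σ₁ ⟨hf1, hrep1⟩
  have hd1 := hd.frame hf1 (by decide) (by decide)
  refine WP.seq (innerLoop_wp hM hR hd1 hU (by rw [hf1 11 (by decide), hp]) hout hrep1) ?_
  rintro σ₂ ⟨hf2, R₂, N₂, w₂, hinv, hrep2⟩
  have hd2 := hd1.frame hf2 (by decide) (by decide)
  refine WP.seq (loadVec_refines (u := u) hR hd2 (fun i => (hrep2 i).1)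
    (fun i => by rw [hf2 9 (by decide), hf1 9 (by decide), h9])) ?_
  rintro σ₃ ⟨hf3, hrep3⟩
  have hd3 := hd2.frame hf3 (by decide) (by decide)
  have hf13 : Frame [8, 10, 12, 13, 14, 15, 16, 17] σ σ₃ :=
    (hf1.trans hf2 (S'' := [8, 10, 12, 13, 14, 15, 16, 17]) (by simp) (by simp)).trans hf3
      (by simp) (by simp)
  refine WP.seq (Q := fun σ' => Frame [8, 10, 12, 13, 14, 15, 16, 17] σ σ' ∧
    σ' 12 0 0 = (p : ℕ) ∧ σ' 8 = σ₃ 8) (t := 100) ?_ ?_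
  · refine WP.assign hR (by decide) le_rfl (fun hb => hb _ _ _) ⟨hf13.write (by simp) _ _ _, ?_, ?_⟩
    · rw [Mem.write_same, eval_var, hf13 11 (by decide), hp]
    · rw [Mem.write_of_ne _ (by decide)]
  rintro σ₄ ⟨hf4, h12, h84⟩
  have hd4 := hd.frame hf4 (by decide) (by decide)
  have htab := hinv.outer.tab
  rw [← h84] at hrep3
  refine WP.seq (pivotProg_refines hR hd4 h12 hrep3 (fun j => htab.abs_entry_le hM j p)
    (htab.exists_ne_zero p) ?_) ?_
  · intro r hr j
    have hstep := (hinv.outer.step hM hinv.conform_col hr).1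
    exact ⟨fun a => (hstep.tab.abs_entry_le hM j a).trans (by omega), (hstep.bound j).trans hUV⟩
  rintro σ₅ ⟨hf5, r, hr, h10, hrep5⟩
  have hd5 := hd4.frame hf5 (by decide) (by decide)
  refine WP.seq (storeVec_wp hR hd5) ?_
  rintro σ₆ ⟨hf6, h96⟩
  refine (emit_wp hR (hd5.frame hf6 (by decide) (by decide))).mono le_rfl ?_
  rintro σ₇ ⟨hf7, g, hg, hgv, h6, h6', h7, h7'⟩
  have hf45 : Frame [8, 10, 12, 13, 14, 15, 16, 17] σ σ₅ := hf4.trans hf5 (by simp) (by simp)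
  have hf46 : Frame [8, 9, 10, 12, 13, 14, 15, 16, 17] σ σ₆ := hf45.trans hf6 (by simp) (by simp)
  refine ⟨hf46.trans hf7 (by simp) (by simp), ?_⟩
  obtain ⟨hstep, hsplit⟩ := hinv.outer.step hM hinv.conform_col hr
  obtain ⟨hel, hmul⟩ := hstep.tab.elementary_col p
  rw [hf46 11 (by decide), hp] at h6 h6' h7 h7'
  rw [hf6 10 (by decide), h10] at h6 hgv
  have hY : (fun j : Fin n => σ₇ 7 (p : ℕ) (j : ℕ))
      = g • fun j : Fin n => pivotMat N₂ p r (Fin.castAdd k j) p := by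
    ext j
    have h1 := (hrep5 (Fin.castAdd k j)).1 p
    rw [Fin.val_castAdd] at h1
    rw [h7 _ (by omega) (by omega), hf6 8 (by decide), h1]
    rfl
  have hprod : ∀ j, |u r| * (stacked T *ᵥ fun j : Fin n => σ₇ 7 (p : ℕ) (j : ℕ)) j
      = u r * pivotMat N₂ p r j p := fun j => by
    rw [hY, mulVec_smul, Pi.smul_apply, hmul, ← hgv, smul_eq_mul]
    rcases hg with rfl | rfl <;> ring
  refine ⟨_, _, _, hstep, fun i j => ?_, fun i => ?_, ?_⟩
  · rw [hf7 8 (by decide), hf6 8 (by decide), (hrep5 i).1]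
  · rw [hf7 9 (by decide), h96 _ (by omega) (by omega), (hrep5 i).2]
  · have hcast : ∀ q : Fin n, q ≠ p → ((q : ℕ) : ℤ) ≠ (p : ℕ) := fun q hq h =>
      hq (Fin.ext (by exact_mod_cast h))
    refine hhist.step (fun q hq => ?_) (fun q hq => ?_) ?_ ?_ fun j => ?_
    · rw [h6' _ (hcast q hq), hf46 6 (by decide)]
    · ext j
      rw [h7' _ _ (hcast q hq), hf46 7 (by decide)]
    · rw [h6]; exact abs_nonneg _
    · rw [hY]
      rcases hg with rfl | rfl
      · rw [one_smul]; exact hel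
      · rw [neg_one_smul]; exact hel.neg
    · have := hsplit j
      rw [← hprod j, ← h6] at this
      exact this

end Refinement

section Correctness

variable {s : ℕ} {V : ℤ} {σ : Mem} {k n X : ℕ}

theorem initUnit_wp (hR : Room s V) (hd : Dims σ k n X V)
    (hbd : ∀ i : ℤ, 0 ≤ i → i < n → |σ 5 i 0 - σ 4 i 0| ≤ V) :
    WP s V initUnit (timeFor X 200) (fun σ' => Frame [8, 9, 13] σ σ' ∧
      (∀ i j : ℤ, 0 ≤ i → i < n → σ' 8 i j = if i = j then 1 else σ 8 i j) ∧
      (∀ i : ℤ, 0 ≤ i → i < n → σ' 9 i 0 = σ 5 i 0 - σ 4 i 0) ∧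
      ∀ i : ℤ, n ≤ i → σ' 9 i 0 = σ 9 i 0) σ := by
  have hX := hd.hX
  have hV := hd.hV
  have hV2 := hR.1
  refine WP.forLoop hR (l := 0) (h := n) (fun r σ' => Frame [8, 9, 13] σ σ' ∧
      (∀ i j : ℤ, 0 ≤ i → i < r → σ' 8 i j = if i = j then 1 else σ 8 i j) ∧
      (∀ i j : ℤ, r ≤ i → σ' 8 i j = σ 8 i j) ∧
      (∀ i : ℤ, 0 ≤ i → i < r → σ' 9 i 0 = σ 5 i 0 - σ 4 i 0) ∧
      ∀ i : ℤ, r ≤ i → σ' 9 i 0 = σ 9 i 0)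
    (by decide) (by decide) rfl (by omega) (by omega) le_rfl (by omega) ?_ ?_ ?_ ?_ ?_
  · exact ⟨Frame.refl _ _, fun i j h1 h2 => by omega, fun _ _ _ => rfl,
      fun i h1 h2 => by omega, fun _ _ => rfl⟩
  · rintro i σ' x ⟨h1, h2⟩
    refine ⟨h1.write (by simp) _ _ _, ?_⟩
    rw [Mem.write_of_ne _ (by decide), Mem.write_of_ne _ (by decide)]
    exact h2
  · rintro i σ' ⟨h1, h2⟩
    exact (hd.frame h1 (by decide) (by decide)).hn
  · rintro r σ₁ hr0 hr1 ⟨h1, h2, h3, h4, h5⟩ hv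
    refine WP.seq (Q := fun σ' => Frame [8, 9, 13] σ σ' ∧ σ' 13 0 0 = r ∧ σ' 9 = σ₁ 9 ∧
      (∀ i j : ℤ, 0 ≤ i → i < r + 1 → σ' 8 i j = if i = j then 1 else σ 8 i j) ∧
      (∀ i j : ℤ, r + 1 ≤ i → σ' 8 i j = σ 8 i j)) (t := 100) (t' := 100) ?_ ?_
    · refine WP.store hR (by decide) (by decide) (by decide) le_rfl
        (fun _ => by simp only [eval_const, abs_one]; omega) ?_
      simp only [eval_var, eval_const, hv]
      refine ⟨h1.write (by simp) _ _ _, ?_, ?_, fun i j i1 i2 => ?_, fun i j i1 => ?_⟩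
      · rw [Mem.write_of_ne _ (by decide), hv]
      · rw [Mem.write_of_ne _ (by decide)]
      · rw [Mem.write_apply]
        by_cases hir : i = r
        · subst hir
          rw [h3 _ _ le_rfl]
          by_cases hij : i = j
          · simp [hij]
          · simp [hij, Ne.symm hij]
        · rw [if_neg (by tauto)]
          exact h2 i j i1 (by omega)
      · rw [Mem.write_apply, if_neg (by omega)]
        exact h3 i j (by omega)
    rintro σ₂ ⟨hf, hv2, e9, h6, h7⟩
    have hev : (Expr.sub (.read 5 (var 13) (.const 0)) (.read 4 (var 13) (.const 0))).eval σ₂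
        = σ 5 r 0 - σ 4 r 0 := by
      simp only [eval_sub, eval_read, eval_var, eval_const, hv2]
      rw [hf 5 (by decide), hf 4 (by decide)]
    refine WP.store hR (by decide) (by decide) (by decide) le_rfl
      (fun _ => by rw [hev]; exact hbd r hr0 hr1) ?_
    rw [hev]
    simp only [eval_var, eval_const, hv2]
    refine ⟨?_, hf.write (by simp) _ _ _, ?_, ?_, fun i i1 i2 => ?_, fun i i1 => ?_⟩
    · rw [Mem.write_of_ne _ (by decide), hv2]
    · rw [Mem.write_of_ne _ (by decide)]; exact h6
    · rw [Mem.write_of_ne _ (by decide)]; exact h7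
    · rw [Mem.write_apply, e9]
      split_ifs with h
      · rw [h.1]
      · exact h4 i i1 (by omega)
    · rw [Mem.write_apply, if_neg (by omega), e9]
      exact h5 i (by omega)
  · exact fun σ' h => ⟨h.1, h.2.1, h.2.2.2⟩

theorem initRows_wp (hR : Room s V) (hd : Dims σ k n X V)
    (h9 : ∀ i : ℤ, n ≤ i → σ 9 i 0 = 0)
    (hbd : ∀ i : ℤ, 0 ≤ i → i < k → ∀ c : ℕ, c ≤ n →
      |∑ j ∈ Finset.range c, σ 2 i j * σ 9 j 0| ≤ V) :
    WP s V initRows (timeFor X (timeFor X 200)) (fun σ' => Frame [8, 9, 13, 14] σ σ' ∧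
      (∀ i j : ℤ, i < n → σ' 8 i j = σ 8 i j) ∧ (∀ i : ℤ, i < n → σ' 9 i 0 = σ 9 i 0) ∧
      (∀ i j : ℤ, 0 ≤ i → i < k → 0 ≤ j → j < n → σ' 8 (n + i) j = σ 2 i j) ∧
      ∀ i : ℤ, 0 ≤ i → i < k →
        σ' 9 (n + i) 0 = ∑ j ∈ Finset.range n, σ 2 i j * σ 9 j 0) σ := by
  have hX := hd.hX
  have hV := hd.hV
  refine WP.forLoop hR (l := 0) (h := k) (fun r σ' => Frame [8, 9, 13, 14] σ σ' ∧
      (∀ i j : ℤ, i < n → σ' 8 i j = σ 8 i j) ∧ (∀ i : ℤ, i < n → σ' 9 i 0 = σ 9 i 0) ∧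
      (∀ i j : ℤ, 0 ≤ i → i < r → 0 ≤ j → j < n → σ' 8 (n + i) j = σ 2 i j) ∧
      (∀ i : ℤ, 0 ≤ i → i < r →
        σ' 9 (n + i) 0 = ∑ j ∈ Finset.range n, σ 2 i j * σ 9 j 0) ∧
      ∀ i : ℤ, r ≤ i → σ' 9 (n + i) 0 = 0)
    (by decide) (by decide) rfl (by omega) (by omega) le_rfl (by omega) ?_ ?_ ?_ ?_ ?_
  · exact ⟨Frame.refl _ _, fun _ _ _ => rfl, fun _ _ => rfl, fun i j h1 h2 => by omega,
      fun i h1 h2 => by omega, fun i hi => h9 _ (by omega)⟩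
  · rintro i σ' x ⟨h1, h2⟩
    refine ⟨h1.write (by simp) _ _ _, ?_⟩
    rw [Mem.write_of_ne _ (by decide), Mem.write_of_ne _ (by decide)]
    exact h2
  · rintro i σ' ⟨h1, h2⟩
    exact (hd.frame h1 (by decide) (by decide)).hk
  · rintro r σ₁ hr0 hr1 ⟨hf1, h81, h91, hT, hS, hz⟩ hv
    refine WP.forLoop hR (l := 0) (h := n) (fun c σ' => Frame [8, 9, 13, 14] σ σ' ∧
        σ' 13 0 0 = r ∧ (∀ i j : ℤ, i ≠ n + r → σ' 8 i j = σ₁ 8 i j) ∧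
        (∀ i : ℤ, i ≠ n + r → σ' 9 i 0 = σ₁ 9 i 0) ∧
        (∀ j : ℤ, 0 ≤ j → j < c → σ' 8 (n + r) j = σ 2 r j) ∧
        σ' 9 (n + r) 0 = ∑ j ∈ Finset.range c.toNat, σ 2 r j * σ 9 j 0)
      (by decide) (by decide) rfl (by omega) (by omega) le_rfl (by omega) ?_ ?_ ?_ ?_ ?_
    · exact ⟨hf1, hv, fun _ _ _ => rfl, fun _ _ => rfl, fun j h1 h2 => by omega,
        by simp [hz r le_rfl]⟩
    · rintro i σ' x ⟨h1, h2⟩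
      refine ⟨h1.write (by simp) _ _ _, ?_⟩
      rw [Mem.write_of_ne _ (by decide), Mem.write_of_ne _ (by decide),
        Mem.write_of_ne _ (by decide)]
      exact h2
    · rintro i σ' ⟨h1, h2⟩
      exact (hd.frame h1 (by decide) (by decide)).hn
    · rintro c σ₂ hc0 hc1 ⟨hf2, hv2, h82, h92, hT2, hS2⟩ hc
      have hn2 := (hd.frame hf2 (by decide) (by decide)).hn
      refine WP.seq (Q := fun σ' => Frame [8, 9, 13, 14] σ σ' ∧ σ' 13 = σ₂ 13 ∧ σ' 14 = σ₂ 14 ∧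
        σ' 9 = σ₂ 9 ∧ (∀ i j : ℤ, i ≠ n + r → σ' 8 i j = σ₁ 8 i j) ∧
        (∀ j : ℤ, 0 ≤ j → j < c + 1 → σ' 8 (n + r) j = σ 2 r j)) (t := 100) (t' := 100) ?_ ?_
      · refine WP.store hR (by decide) (by decide) (by decide) le_rfl (fun hb => hb _ _ _) ?_
        simp only [eval_add, eval_read, eval_var, hv2, hn2, hc]
        refine ⟨hf2.write (by simp) _ _ _, ?_, ?_, ?_, fun i j hi => ?_, fun j j1 j2 => ?_⟩
        · rw [Mem.write_of_ne _ (by decide)]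
        · rw [Mem.write_of_ne _ (by decide)]
        · rw [Mem.write_of_ne _ (by decide)]
        · rw [Mem.write_apply, if_neg (by tauto)]
          exact h82 i j hi
        · rw [Mem.write_apply, hf2 2 (by decide)]
          split_ifs with h
          · rw [h.2]
          · exact hT2 j j1 (by omega)
      rintro σ₃ ⟨hf3, e13, e14, e9, h83, hT3⟩
      have hn3 := (hd.frame hf3 (by decide) (by decide)).hn
      have hnat : (c + 1).toNat = c.toNat + 1 := by omega
      have hcc : ((c.toNat : ℕ) : ℤ) = c := by omega
      have hev : (Expr.add (.read 9 (.add (var 1) (var 13)) (.const 0))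
            (.mul (.read 2 (var 13) (var 14)) (.read 9 (var 14) (.const 0)))).eval σ₃
          = ∑ j ∈ Finset.range (c + 1).toNat, σ 2 r j * σ 9 j 0 := by
        simp only [eval_add, eval_mul, eval_read, eval_var, eval_const, e13, e14, hv2, hn3, hc, e9]
        rw [hnat, Finset.sum_range_succ, hS2, hcc, hf3 2 (by decide), h92 c (by omega),
          h91 c hc1]
      refine WP.store hR (by decide) (by decide) (by decide) le_rfl
        (fun _ => by rw [hev]; exact hbd r hr0 hr1 _ (by omega)) ?_
      rw [hev]
      simp only [eval_add, eval_var, eval_const, e13, hv2, hn3]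
      refine ⟨?_, hf3.write (by simp) _ _ _, ?_, ?_, fun i hi => ?_, ?_, ?_⟩
      · rw [Mem.write_of_ne _ (by decide), e14, hc]
      · rw [Mem.write_of_ne _ (by decide), e13, hv2]
      · rw [Mem.write_of_ne _ (by decide)]; exact h83
      · rw [Mem.write_apply, if_neg (by tauto), e9]
        exact h92 i hi
      · rw [Mem.write_of_ne _ (by decide)]; exact hT3
      · rw [Mem.write_same]
    · rintro σ' ⟨h1, h2, h3, h4, h5, h6⟩
      refine ⟨h2, h1, fun i j hi => ?_, fun i hi => ?_, fun i j i1 i2 j1 j2 => ?_,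
        fun i i1 i2 => ?_, fun i i1 => ?_⟩
      · rw [h3 i j (by omega), h81 i j hi]
      · rw [h4 i (by omega), h91 i hi]
      · by_cases hir : i = r
        · rw [hir]; exact h5 j j1 j2
        · rw [h3 _ _ (by omega)]; exact hT i j i1 (by omega) j1 j2
      · by_cases hir : i = r
        · rw [hir, h6, Int.toNat_natCast]
        · rw [h4 _ (by omega)]; exact hS i i1 (by omega)
      · rw [h4 _ (by omega)]; exact hz i (by omega)
  · exact fun σ' h => ⟨h.1, h.2.1, h.2.2.1, h.2.2.2.1, h.2.2.2.2.1⟩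

theorem arrayOf_apply (A : Matrix (Fin k) (Fin n) ℤ) (i : Fin k) (j : Fin n) :
    arrayOf A (i : ℕ) (j : ℕ) = A i j := by
  change (if h : (i : ℕ) < k ∧ (j : ℕ) < n then A ⟨i, h.1⟩ ⟨j, h.2⟩ else 0) = A i j
  rw [dif_pos ⟨i.2, j.2⟩]

theorem abs_arrayOf_le (A : Matrix (Fin k) (Fin n) ℤ) (hV : 0 ≤ V) (hA : ∀ i j, |A i j| ≤ V)
    (i j : ℤ) : |arrayOf A i j| ≤ V := by
  unfold arrayOf
  split
  · split_ifs
    · exact hA _ _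
    · simpa using hV
  · simpa using hV

theorem arrayOf_replicateCol (v : Fin n → ℤ) (i : Fin n) :
    arrayOf (Matrix.replicateCol (Fin 1) v) (i : ℕ) 0 = v i :=
  arrayOf_apply (Matrix.replicateCol (Fin 1) v) i 0

theorem abs_lt_of_bitLength_le {z : ℤ} {L : ℕ} (h : bitLength z ≤ L) : |z| < 2 ^ L := by
  have h1 : z.natAbs < 2 ^ L :=
    (Nat.lt_size_self _).trans_le (Nat.pow_le_pow_right (by norm_num) (by unfold bitLength at h; omega))
  rw [Int.abs_eq_natAbs]
  exact_mod_cast h1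

theorem bitLength_le_of_abs_le {z : ℤ} {m : ℕ} (h : |z| ≤ 2 ^ m) : bitLength z ≤ m + 2 := by
  have h1 : z.natAbs ≤ 2 ^ m := by
    rw [Int.abs_eq_natAbs] at h
    exact_mod_cast h
  have h2 : Nat.size z.natAbs ≤ m + 1 :=
    Nat.size_le.mpr (h1.trans_lt (Nat.pow_lt_pow_right (by norm_num) (by omega)))
  unfold bitLength
  omega

theorem one_le_bitLength (z : ℤ) : 1 ≤ bitLength z := Nat.le_add_left _ _

theorem card_le_sum_bitLength (v : Fin n → ℤ) : n ≤ ∑ j, bitLength (v j) := by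
  simpa using Finset.card_nsmul_le_sum Finset.univ (fun j => bitLength (v j)) 1
    (fun j _ => one_le_bitLength _)

theorem bitLength_le_sum (v : Fin n → ℤ) (j : Fin n) : bitLength (v j) ≤ ∑ j, bitLength (v j) :=
  Finset.single_le_sum (f := fun j => bitLength (v j)) (fun _ _ => Nat.zero_le _)
    (Finset.mem_univ j)

/-- The program decomposes `y - x₀`, whenever the given bounds are large enough. -/
theorem decomposeProg_wp {T : Matrix (Fin k) (Fin n) ℤ} {b : Fin k → ℤ} {x₀ y : Fin n → ℤ}
    (hT : T.IsTotallyUnimodular) (hx : T *ᵥ x₀ ≤ b) (hy : T *ᵥ y ≤ b) (hR : Room s V)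
    (hX : n + k + 1 ≤ X) (hV : (n + k + 1 : ℤ) ≤ V) {Z : ℤ} (hZ0 : 0 ≤ Z)
    (hZ : ∀ j, |y j - x₀ j| ≤ Z) (hZV : (n + 1) * ((n + 1) * Z) ≤ V) :
    WP s V decomposeProg (timeTotal X) (fun σ => IsDecomposition T b x₀ y
      (fun i => σ 6 (i : ℕ) 0) (fun i j => σ 7 (i : ℕ) (j : ℕ))) (inputMem T b x₀ y) := by
  set σ := inputMem T b x₀ y with hσ
  have hM := unimodularWith_row hT
  have hd : Dims σ k n X V := by
    refine ⟨?_, ?_, hX, hV⟩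
    · exact arrayOf_replicateCol (fun _ : Fin 1 => (k : ℤ)) 0
    · exact arrayOf_replicateCol (fun _ : Fin 1 => (n : ℤ)) 0
  have e2 : ∀ (i : Fin k) (j : Fin n), σ 2 (i : ℕ) (j : ℕ) = T i j := arrayOf_apply T
  have e4 : ∀ i : Fin n, σ 4 (i : ℕ) 0 = x₀ i := arrayOf_replicateCol x₀
  have e5 : ∀ i : Fin n, σ 5 (i : ℕ) 0 = y i := arrayOf_replicateCol y
  have e8 : σ 8 = fun _ _ => 0 := rfl
  have e9 : σ 9 = fun _ _ => 0 := rfl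
  set U : ℤ := (n + 1) * Z with hUdef
  have hn0 : (0 : ℤ) ≤ n := by omega
  have hZU : Z ≤ U := by nlinarith
  have hnZU : n * Z ≤ U := by nlinarith
  have hU0 : 0 ≤ U := by positivity
  have hUV : U ≤ V := by nlinarith
  have hnU : n * U ≤ V := by nlinarith
  refine WP.seq (initUnit_wp hR hd ?_) ?_
  · intro i h0 h1
    obtain ⟨a, rfl⟩ := exists_fin_cast h0 h1
    rw [e5, e4]
    exact (hZ a).trans (hZU.trans hUV)
  rintro σ₁ ⟨hf1, h8, h9, h9'⟩
  have hd1 := hd.frame hf1 (by decide) (by decide)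
  have h9f : ∀ j : Fin n, σ₁ 9 (j : ℕ) 0 = y j - x₀ j := fun j => by
    rw [h9 _ (by omega) (by omega), e5, e4]
  have hTle : ∀ i j, |T i j| ≤ 1 := fun i j => by
    obtain ⟨t, ht⟩ := hT.apply i j
    rw [← ht]; cases t <;> simp
  have hpart : ∀ (a : Fin k) (c : ℕ), c ≤ n →
      |∑ j ∈ Finset.range c, σ₁ 2 (a : ℕ) j * σ₁ 9 j 0| ≤ U := fun a c hc => by
    refine (Finset.abs_sum_le_sum_abs _ _).trans ?_
    have : ∀ j ∈ Finset.range c, |σ₁ 2 (a : ℕ) j * σ₁ 9 j 0| ≤ Z := fun j hj => by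
      have hjn : j < n := (Finset.mem_range.mp hj).trans_le hc
      have h1 := e2 a ⟨j, hjn⟩
      have h2 := h9f ⟨j, hjn⟩
      simp only at h1 h2
      rw [hf1 2 (by decide), h1, h2, abs_mul]
      have h3 := hTle a ⟨j, hjn⟩
      have h4 := hZ ⟨j, hjn⟩
      nlinarith [abs_nonneg (y ⟨j, hjn⟩ - x₀ ⟨j, hjn⟩)]
    have h5 := Finset.sum_le_card_nsmul _ _ _ this
    rw [Finset.card_range, nsmul_eq_mul] at h5
    have : (c : ℤ) ≤ n := by exact_mod_cast hc
    nlinarith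
  refine WP.seq (initRows_wp hR hd1 (fun i hi => by rw [h9' i hi, e9]) ?_) ?_
  · intro i h0 h1 c hc
    obtain ⟨a, rfl⟩ := exists_fin_cast h0 h1
    exact (hpart a c hc).trans hUV
  rintro σ₂ ⟨hf2, h82, h92, hT2, hS2⟩
  have hd2 := hd1.frame hf2 (by decide) (by decide)
  set u₀ := stacked T *ᵥ (y - x₀) with hu₀
  have h9u : ∀ i : Fin (n + k), σ₂ 9 (i : ℕ) 0 = u₀ i := fun i => by
    refine Fin.addCases (fun a => ?_) (fun a => ?_) i
    · rw [hu₀, stacked_mulVec_castAdd, Fin.val_castAdd, h92 _ (by omega), h9f]; rfl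
    · rw [hu₀, stacked_mulVec_natAdd, Fin.val_natAdd, Nat.cast_add,
        hS2 _ (by omega) (by omega), Finset.sum_range]
      refine Finset.sum_congr rfl fun j _ => ?_
      rw [hf1 2 (by decide), e2, h9f]; rfl
  have hubd : ∀ i, |u₀ i| ≤ U := fun i => by
    refine Fin.addCases (fun a => ?_) (fun a => ?_) i
    · rw [hu₀, stacked_mulVec_castAdd]; exact (hZ a).trans hZU
    · have h1 := h9u (Fin.natAdd n a)
      rw [Fin.val_natAdd, Nat.cast_add, hS2 _ (by omega) (by omega)] at h1
      rw [← h1]; exact hpart a n le_rfl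
  have hinit : RoundInv T U u₀ 0 σ₂ := by
    refine ⟨Fin.castAdd k, stacked T, u₀,
      ⟨isTableau_stacked T, ⟨_, hu₀⟩, fun a ha => absurd ha (Nat.not_lt_zero _), hubd⟩,
      fun i j => ?_, h9u,
      ⟨fun j => SignConform.refl _, fun q hq => absurd hq (Nat.not_lt_zero _),
        fun q hq => absurd hq (Nat.not_lt_zero _), fun q hq => absurd hq (Nat.not_lt_zero _),
        fun j => by simp⟩⟩
    refine Fin.addCases (fun a => ?_) (fun a => ?_) i
    · rw [stacked_castAdd, Fin.val_castAdd, h82 _ _ (by omega), h8 _ _ (by omega) (by omega), e8]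
      simp only [Pi.single_apply, Nat.cast_inj, Fin.val_inj, eq_comm]
    · rw [stacked_natAdd, Fin.val_natAdd, Nat.cast_add,
        hT2 _ _ (by omega) (by omega) (by omega) (by omega), hf1 2 (by decide), e2]
  refine WP.forLoop hR (l := 0) (h := n)
    (fun p σ' => Dims σ' k n X V ∧ RoundInv T U u₀ p.toNat σ')
    (by decide) (by decide) rfl (by omega) (by omega) le_rfl (by omega) ⟨hd2, hinit⟩ ?_ ?_ ?_ ?_
  · rintro i σ' x ⟨h1, h2⟩
    refine ⟨h1.frame ((Frame.refl [11] σ').write (by simp) _ _ _) (by decide) (by decide), ?_⟩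
    unfold RoundInv
    rw [Mem.write_of_ne _ (by decide), Mem.write_of_ne _ (by decide),
      Mem.write_of_ne _ (by decide), Mem.write_of_ne _ (by decide)]
    exact h2
  · exact fun i σ' h => h.1.hn
  · rintro i σ' h0 h1 ⟨h2, h3⟩ hv
    obtain ⟨p, rfl⟩ := exists_fin_cast h0 h1
    rw [Int.toNat_natCast] at h3
    refine (roundProg_wp hT hR h2 hnU hUV hv h3).mono le_rfl ?_
    rintro σ'' ⟨hf, hinv⟩
    have hnat : ((p : ℕ) + 1 : ℤ).toNat = p + 1 := by omega
    rw [hnat]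
    exact ⟨by rw [hf 11 (by decide), hv], h2.frame hf (by decide) (by decide), hinv⟩
  · rintro σ' ⟨-, R, N, u, hout, -, -, hhist⟩
    rw [Int.toNat_natCast] at hout hhist
    refine isDecomposition_of_conform hx hy (fun i => hhist.nonneg i i.2)
      (fun i => hhist.elementary i i.2) (fun j => ?_) fun i j => hhist.term i i.2 j
    have := hhist.sum j
    simpa [hout.eq_zero j] using this

theorem bounded_inputMem {T : Matrix (Fin k) (Fin n) ℤ} {b : Fin k → ℤ} {x₀ y : Fin n → ℤ}
    (hV : 0 ≤ V) (hk : (k : ℤ) ≤ V) (hn : (n : ℤ) ≤ V) (hT : ∀ i j, |T i j| ≤ V)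
    (hb : ∀ i, |b i| ≤ V) (hx : ∀ j, |x₀ j| ≤ V) (hy : ∀ j, |y j| ≤ V) :
    Bounded V (inputMem T b x₀ y) := by
  intro a i j
  unfold inputMem
  split
  · exact abs_arrayOf_le _ hV (fun _ _ => by simpa using hk) i j
  · exact abs_arrayOf_le _ hV (fun _ _ => by simpa using hn) i j
  · exact abs_arrayOf_le _ hV hT i j
  · exact abs_arrayOf_le _ hV (fun i _ => hb i) i j
  · exact abs_arrayOf_le _ hV (fun i _ => hx i) i j
  · exact abs_arrayOf_le _ hV (fun i _ => hy i) i j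
  · simpa using hV

theorem eval_timeTotal (x : ℕ) :
    (timeTotal (Polynomial.X : Polynomial ℕ)).eval x = timeTotal x := by
  simp [timeTotal, timeRound, timeEmit, timePivot, timeElim, timeSave, timeSearch, timeFor]

end Correctness

/-- Decomposition lemma. One program `P` computes, for every totally unimodular system `T x ≤ b` and
all integral solutions `x₀`, `y`, a decomposition of `y - x₀` (the coefficients in array `6`, the
vectors as the rows of array `7`). It is strongly polynomial: the number of elementary steps is
polynomial in the number of input integers, and all numbers that occur have encoding length
polynomial in that of the input. -/
theorem lemma6 :
    ∃ (P : Prog) (p q : Polynomial ℕ),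
      ∀ (k n : ℕ) (T : Matrix (Fin k) (Fin n) ℤ) (b : Fin k → ℤ) (x₀ y : Fin n → ℤ),
        T.IsTotallyUnimodular → T *ᵥ x₀ ≤ b → T *ᵥ y ≤ b →
        ∃ (t : ℕ) (σ : Mem),
          Exec (q.eval (inputLength T b x₀ y)) P (inputMem T b x₀ y) t σ ∧
          t ≤ p.eval (inputCount k n) ∧
          IsDecomposition T b x₀ y
            (fun i => σ 6 (i : ℕ) 0) (fun i j => σ 7 (i : ℕ) (j : ℕ)) := by
  refine ⟨decomposeProg, timeTotal Polynomial.X, 90 * Polynomial.X + 62, ?_⟩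
  intro k n T b x₀ y hT hx hy
  set L := inputLength T b x₀ y with hL
  have hTle : ∀ i j, |T i j| ≤ 1 := fun i j => by
    obtain ⟨t, ht⟩ := hT.apply i j
    rw [← ht]; cases t <;> simp
  have hkL : k ≤ ∑ i, bitLength (b i) := card_le_sum_bitLength b
  have hnL : n ≤ ∑ j, bitLength (x₀ j) := card_le_sum_bitLength x₀
  have hL2 : n + k + 2 ≤ L := by
    have h1 := one_le_bitLength (k : ℤ)
    have h2 := one_le_bitLength (n : ℤ)
    rw [hL, inputLength]
    omega
  have hbL : ∀ i, |b i| < 2 ^ L := fun i => abs_lt_of_bitLength_le (by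
    have := bitLength_le_sum b i; rw [hL, inputLength]; omega)
  have hxL : ∀ j, |x₀ j| < 2 ^ L := fun j => abs_lt_of_bitLength_le (by
    have := bitLength_le_sum x₀ j; rw [hL, inputLength]; omega)
  have hyL : ∀ j, |y j| < 2 ^ L := fun j => abs_lt_of_bitLength_le (by
    have := bitLength_le_sum y j; rw [hL, inputLength]; omega)
  set D : ℤ := 2 ^ L with hD
  set V : ℤ := 2 ^ (3 * L + 2) with hV
  have hDV : V = 4 * (D * D * D) := by rw [hV, hD]; ring
  have hLD : (n + k + 2 : ℤ) ≤ D := by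
    have : L < 2 ^ L := Nat.lt_two_pow_self
    have h1 : n + k + 2 ≤ 2 ^ L := by omega
    rw [hD]; exact_mod_cast h1
  have hD2 : 2 ≤ D := by omega
  have hDD : D ≤ D * D := by nlinarith
  have hDDD : D * D ≤ D * D * D := by nlinarith
  have hR : Room (90 * L + 62) V := by
    refine ⟨by omega, fun z hz => ?_⟩
    have h1 : V ^ 30 = 2 ^ (90 * L + 60) := by rw [hV, ← pow_mul]; ring_nf
    rw [h1] at hz
    exact bitLength_le_of_abs_le hz
  have hB : Bounded V (inputMem T b x₀ y) := by
    refine bounded_inputMem (by omega) (by omega) (by omega) (fun i j => ?_) (fun i => ?_)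
      (fun j => ?_) (fun j => ?_)
    · have := hTle i j; omega
    · have := hbL i; omega
    · have := hxL j; omega
    · have := hyL j; omega
  have hX : n + k + 1 ≤ inputCount k n := by
    have := Nat.zero_le (k * n)
    rw [inputCount]; omega
  have hZV : ((n : ℤ) + 1) * ((n + 1) * (2 * D)) ≤ V := by
    have h1 : (n : ℤ) + 1 ≤ D := by omega
    have h2 : ((n : ℤ) + 1) * (n + 1) ≤ D * D := mul_le_mul h1 h1 (by omega) (by omega)
    rw [hDV]
    nlinarith
  obtain ⟨t, σ, h1, h2, -, h4⟩ := decomposeProg_wp hT hx hy hR hX (by omega)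
    (Z := 2 * D) (by omega) (fun j => by
      have h1 := hxL j
      have h2 := hyL j
      have h3 := abs_sub (y j) (x₀ j)
      omega) hZV hB
  refine ⟨t, σ, ?_, ?_, h4⟩
  · simpa using h2
  · rw [eval_timeTotal]; exact h1
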